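/- Let $I,J\subseteq\mathbb R$ be open intervals (bounded or unbounded) and let $V_a\in C^2(I)$, $V_b\in C^2(J)$ be real potentials such that $V_a$ (resp. $V_b$) tends to $+\infty$ at every finite endpoint of $I$ (resp. $J$); nothing is assumed at infinite endpoints. Consider on the phase space $M=\{(x,p_x,y,p_y): x\in I,\ y\in J,\ p_x,p_y\in\mathbb R\}$ the Hamiltonian $$H=\tfrac12p_x^2+\tfrac12p_y^2+V_a(x)+V_b(y)=H_a+H_b,\qquad H_a=\tfrac12p_x^2+V_a(x),\quad H_b=\tfrac12p_y^2+V_b(y),$$ and assume that $H$ has a strict local minimum in $M$. An integral of motion is a function $F\in C^1(M)$ whose Poisson bracket with $H$ vanishes, $\{F,H\}=0$ on $M$. The Hamiltonian $H$ is called maximally superintegrable if there is an integral of motion $Q$ such that $H_a,H_b,Q$ are functionally independent, i.e. $dH_a,dH_b,dQ$ are linearly independent at all points of a dense subset of $M$. A potential $V$ on an open interval is called isochronous with period $T$ if it has a strict local minimum and every bounded trajectory of $\dot x=p$, $\dot p=-V'(x)$, other than an equilibrium, is periodic with minimal period $T$. Then $H$ is maximally superintegrable if and only if $V_a$ and $V_b$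 are isochronous with commensurable periods, i.e. isochronous with periods $T_a$ and $T_b$ such that $T_a/T_b\in\mathbb Q$. -/

import Mathlib

open Set Filter Topology

noncomputable section

/-- The point `z` is a strict local minimum of `f`. -/
def IsStrictLocalMin {X : Type*} [TopologicalSpace X] (f : X → ℝ) (z : X) : Prop :=
  ∀ᶠ w in 𝓝[≠] z, f z < f w

/-- Phase space points of one degree of freedom are written `(x, p)`; those of two degrees of
freedom are written `((x, p_x), (y, p_y))`. -/
abbrev Phase2 : Type := (ℝ × ℝ) × (ℝ × ℝ)

/-- The phase space `I × ℝ × J × ℝ` over the configuration space `I × J`. -/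
def phaseSpace (I J : Set ℝ) : Set Phase2 := (I ×ˢ univ) ×ˢ (J ×ˢ univ)

/-- The one-dimensional Hamiltonian `p² / 2 + V(x)`. -/
def hamiltonian1 (V : ℝ → ℝ) (w : ℝ × ℝ) : ℝ := w.2 ^ 2 / 2 + V w.1

/-- The separable Hamiltonian `p_x² / 2 + p_y² / 2 + V_a(x) + V_b(y)`. -/
def separableHamiltonian (Va Vb : ℝ → ℝ) (z : Phase2) : ℝ :=
  z.1.2 ^ 2 / 2 + z.2.2 ^ 2 / 2 + Va z.1.1 + Vb z.2.1

/-- The canonical Poisson bracket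
`{F, G} = F_x G_{p_x} - F_{p_x} G_x + F_y G_{p_y} - F_{p_y} G_y`. -/
def poissonBracket (F G : Phase2 → ℝ) (z : Phase2) : ℝ :=
  (fderiv ℝ F z ((1, 0), (0, 0)) * fderiv ℝ G z ((0, 1), (0, 0))
    - fderiv ℝ F z ((0, 1), (0, 0)) * fderiv ℝ G z ((1, 0), (0, 0)))
  + (fderiv ℝ F z ((0, 0), (1, 0)) * fderiv ℝ G z ((0, 0), (0, 1))
    - fderiv ℝ F z ((0, 0), (0, 1)) * fderiv ℝ G z ((0, 0), (1, 0)))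

/-- `F` is a (globally defined, single-valued, `C¹`) integral of motion of `H` on the open
set `M`. -/
def IsIntegralOfMotion (M : Set Phase2) (H F : Phase2 → ℝ) : Prop :=
  ContDiffOn ℝ 1 F M ∧ ∀ z ∈ M, poissonBracket F H z = 0

/-- Functional independence on `M`: the differentials are linearly independent at the points of a
dense subset of `M`. -/
def FunctionallyIndependentOn {k : ℕ} (M : Set Phase2) (F : Fin k → Phase2 → ℝ) : Prop :=
  M ⊆ closure {z ∈ M | LinearIndependent ℝ (fun i => fderiv ℝ (F i) z)}

/-- The separable Hamiltonian on `I × ℝ × J × ℝ` is maximally superintegrable: in addition to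
`H_a` and `H_b` there is a third integral of motion `Q`, with `H_a, H_b, Q` functionally
independent. -/
def MaximallySuperintegrable (I J : Set ℝ) (Va Vb : ℝ → ℝ) : Prop :=
  ∃ Q : Phase2 → ℝ,
    IsIntegralOfMotion (phaseSpace I J) (separableHamiltonian Va Vb) Q ∧
    FunctionallyIndependentOn (phaseSpace I J)
      ![fun z => hamiltonian1 Va z.1, fun z => hamiltonian1 Vb z.2, Q]

/-- A trajectory, defined for all times, of Hamilton's equations `x' = p`, `p' = -V'(x)` on
`I × ℝ`. -/
def IsTrajectory (I : Set ℝ) (V : ℝ → ℝ) (γ : ℝ → ℝ × ℝ) : Prop :=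
  ∀ t, (γ t).1 ∈ I ∧ HasDerivAt γ ((γ t).2, -deriv V (γ t).1) t

/-- `T` is the (minimal positive) period of `γ`. -/
def HasPeriod (γ : ℝ → ℝ × ℝ) (T : ℝ) : Prop :=
  IsLeast {S : ℝ | 0 < S ∧ Function.Periodic γ S} T

/-- The potential `V` on `I` is isochronous with period `T`: it has a strict local minimum and
every bounded trajectory, other than an equilibrium, is periodic with period `T`. -/
def IsIsochronousWithPeriod (I : Set ℝ) (V : ℝ → ℝ) (T : ℝ) : Prop :=
  (∃ x ∈ I, IsStrictLocalMin V x) ∧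
  ∀ γ : ℝ → ℝ × ℝ, IsTrajectory I V γ → Bornology.IsBounded (range γ) →
    (¬ ∃ c, ∀ t, γ t = c) → HasPeriod γ T

end

/-! Necessity. Let `Q` be a third integral and take periodic trajectories of the two factors, with
periods `τ` and `σ`. Since `Q` is constant along the joint flow, its restriction to the first
trajectory, with the point of the second held fixed, has both `τ` and `σ` as periods. If `τ / σ`
were irrational this restriction would be constant, so `Q` would not vary along the first
Hamiltonian field; where both fields are nonzero that contradicts independence
(`linearIndependent_differentials_iff`, `IsIntegralOfMotion.exists_rat_eq_div`). Hence the ratio of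
periods is rational for a dense open set of pairs of nearby tori. Periods are `C¹` in the momentum
at the bottom of the well, and a continuous rational-valued function on an interval is constant, so
the periods are locally constant (`eventually_eq_of_rational_ratio`). A regular energy slightly
above the minimum supplies a first periodic trajectory (`exists_mem_periodicMomenta`). Its period
then spreads to all momenta by connectedness: in a fixed period, a trajectory of bounded speed
covers a bounded distance, so it cannot escape to infinity, and finite endpoints are shielded by the
blow-up of the potential (`periodicMomenta_eq_Ioi`). The trajectories so obtained fill the whole
phase space except for the equilibrium (`isPeriodicWell_of_isOpen`). Sufficiency. In an isochronous
well the first Fourier coefficient `Z` of the momentum along the trajectory through a point is a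
`C¹` function of that point, even at the equilibrium, and turns with angular speed `2π / T`;
symmetry about a turning point shows that it vanishes only at the equilibrium
(`IsPeriodicWell.exists_rotating_function`). If `n / Ta = m / Tb`, the phases cancel in `Za ^ n *
conj Zb ^ m`, whose real part is the required integral. -/

open scoped NNReal BoundedContinuousFunction

/-! ### Global flows of Lipschitz `C¹` vector fields and their differentiability. -/

section Flow

/-- Continuity in `w` uniformly on compact time intervals, plus continuity in `t`, gives joint
continuity by the triangle inequality. It serves both for the flow and for its derivative in the
initial point. -/
theorem continuous_uncurry_of_forall_eventually_Icc {X F : Type*} [TopologicalSpace X]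
    [NormedAddCommGroup F]
    {Ψ : ℝ → X → F} (ht : ∀ w, Continuous fun t => Ψ t w)
    (hw : ∀ (w : X) (T ε : ℝ), 0 < ε → ∀ᶠ w' in 𝓝 w, ∀ t ∈ Icc (-T) T, ‖Ψ t w' - Ψ t w‖ ≤ ε) :
    Continuous fun q : ℝ × X => Ψ q.1 q.2 := by
  refine continuous_iff_continuousAt.2 fun ⟨t, w⟩ => Metric.tendsto_nhds.2 fun ε hε => ?_
  have h1 : ∀ᶠ q : ℝ × X in 𝓝 (t, w), dist (Ψ q.1 w) (Ψ t w) < ε / 2 :=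
    (continuousAt_fst (p := (t, w))).eventually
      (Metric.tendsto_nhds.1 ((ht w).continuousAt (x := t)) (ε / 2) (half_pos hε))
  have h2 := (continuousAt_snd (p := (t, w))).eventually (hw w (|t| + 1) (ε / 2) (half_pos hε))
  have h3 : ∀ᶠ q : ℝ × X in 𝓝 (t, w), q.1 ∈ Icc (-(|t| + 1)) (|t| + 1) :=
    continuousAt_fst.eventually (Icc_mem_nhds (by linarith [neg_abs_le t]) (by linarith [le_abs_self t]))
  filter_upwards [h1, h2, h3] with q hq1 hq2 hq3
  have := hq2 q.1 hq3
  rw [← dist_eq_norm] at this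
  have h4 := dist_triangle (Ψ q.1 q.2) (Ψ q.1 w) (Ψ t w)
  linarith

variable {E : Type*} [NormedAddCommGroup E] [NormedSpace ℝ E]

/-- Integration gains a factor `1 / l` in the norm weighted by `exp (l * |t|)`; this turns the
Picard operator into a contraction on the whole line. -/
theorem norm_integral_le_of_norm_le_exp_abs {F : ℝ → E} {c l : ℝ} (hl : 0 < l)
    (hF : ∀ s, ‖F s‖ ≤ c * Real.exp (l * |s|)) (t : ℝ) :
    ‖∫ s in (0 : ℝ)..t, F s‖ ≤ c / l * Real.exp (l * |t|) := by
  have hc : 0 ≤ c := by simpa using (norm_nonneg _).trans (hF 0)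
  have key : ∀ (F : ℝ → E), (∀ s, ‖F s‖ ≤ c * Real.exp (l * |s|)) → ∀ t, 0 ≤ t →
      ‖∫ s in (0 : ℝ)..t, F s‖ ≤ c / l * Real.exp (l * t) := by
    intro F hF t ht
    have h1 : ‖∫ s in (0 : ℝ)..t, F s‖ ≤ ∫ s in (0 : ℝ)..t, c * Real.exp (l * s) := by
      refine intervalIntegral.norm_integral_le_of_norm_le ht ?_
        (Continuous.intervalIntegrable (by fun_prop) _ _)
      filter_upwards with s hs
      simpa [abs_of_pos hs.1] using hF s
    have h2 : ∫ s in (0 : ℝ)..t, c * Real.exp (l * s)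
        = c / l * Real.exp (l * t) - c / l * Real.exp (l * 0) := by
      refine intervalIntegral.integral_eq_sub_of_hasDerivAt (f := fun s => c / l * Real.exp (l * s))
        (fun s _ => ?_) (Continuous.intervalIntegrable (by fun_prop) _ _)
      refine ((((hasDerivAt_id s).const_mul l).exp).const_mul (c / l)).congr_deriv ?_
      have := hl.ne'
      simp only [id]
      field_simp
    rw [h2] at h1
    have : 0 ≤ c / l * Real.exp (l * 0) := by positivity
    linarith
  rcases le_total 0 t with ht | ht
  · simpa [abs_of_nonneg ht] using key F hF t ht
  · have h := key (fun s => F (-s)) (fun s => by simpa using hF (-s)) (-t) (by linarith)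
    rw [intervalIntegral.integral_comp_neg, neg_neg, neg_zero, intervalIntegral.integral_symm,
      norm_neg] at h
    simpa [abs_of_nonpos ht] using h

/-- Global solvability of a nonautonomous ordinary differential equation with a uniformly
Lipschitz right-hand side. -/
theorem exists_forall_hasDerivAt_of_lipschitz [CompleteSpace E] {v : ℝ → E → E}
    (hv : Continuous fun q : ℝ × E => v q.1 q.2) {K : ℝ≥0} (hK : ∀ t, LipschitzWith K (v t))
    {C : ℝ} (hC : ∀ t, ‖v t 0‖ ≤ C) (w : E) :
    ∃ γ : ℝ → E, γ 0 = w ∧ ∀ t, HasDerivAt γ (v t (γ t)) t := by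
  -- With weight `exp (l * |t|)` the contraction constant is `K / l`, so any `l > K` works. The
  -- unknown `u` is the solution divided by the weight, which makes it bounded.
  set l : ℝ := K + 1 with hl
  have hl0 : 0 < l := by positivity
  let e : ℝ → ℝ := fun t => Real.exp (l * |t|)
  have he0 : ∀ t, 0 < e t := fun t => Real.exp_pos _
  have he1 : ∀ t, 1 ≤ e t := fun t => Real.one_le_exp (by positivity)
  have hec : Continuous e := by fun_prop
  have hcont : ∀ u : ℝ →ᵇ E, Continuous fun s => v s (e s • u s) := fun u =>
    hv.comp (continuous_id.prodMk (hec.smul u.continuous))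
  have hbound : ∀ (u : ℝ →ᵇ E) s, ‖v s (e s • u s)‖ ≤ (C + K * ‖u‖) * e s := by
    intro u s
    have h1 : ‖v s (e s • u s)‖ ≤ ‖v s 0‖ + K * ‖e s • u s‖ := by
      have := (hK s).dist_le_mul (e s • u s) 0
      rw [dist_eq_norm, dist_zero_right] at this
      have h2 := norm_le_norm_add_norm_sub' (v s (e s • u s)) (v s 0)
      linarith
    have h3 : ‖e s • u s‖ ≤ ‖u‖ * e s := by
      rw [norm_smul, Real.norm_of_nonneg (he0 s).le, mul_comm]
      exact mul_le_mul_of_nonneg_right (u.norm_coe_le_norm s) (he0 s).le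
    have hC0 : 0 ≤ C := (norm_nonneg _).trans (hC 0)
    have h4 : C ≤ C * e s := le_mul_of_one_le_right hC0 (he1 s)
    have h5 : (K : ℝ) * ‖e s • u s‖ ≤ K * (‖u‖ * e s) := by gcongr
    have := hC s
    linarith
  let N : (ℝ →ᵇ E) → (ℝ →ᵇ E) := fun u =>
    BoundedContinuousFunction.ofNormedAddCommGroup
      (fun t => (e t)⁻¹ • (w + ∫ s in (0 : ℝ)..t, v s (e s • u s)))
      ((hec.inv₀ fun t => (he0 t).ne').smul (continuous_const.add
        (intervalIntegral.continuous_primitive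
          (fun a b => (hcont u).intervalIntegrable a b) 0)))
      (‖w‖ + (C + K * ‖u‖) / l) (by
        intro t
        have h1 := norm_integral_le_of_norm_le_exp_abs hl0 (hbound u) t
        rw [norm_smul, norm_inv, Real.norm_of_nonneg (he0 t).le, inv_mul_le_iff₀ (he0 t)]
        have h2 : ‖w‖ ≤ e t * ‖w‖ := le_mul_of_one_le_left (norm_nonneg _) (he1 t)
        have h3 := norm_add_le w (∫ s in (0 : ℝ)..t, v s (e s • u s))
        change _ ≤ _ * e t at h1
        linarith)
  have hNapp : ∀ u t, N u t = (e t)⁻¹ • (w + ∫ s in (0 : ℝ)..t, v s (e s • u s)) :=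
    fun u t => rfl
  have hN : ContractingWith (K / (K + 1)) N := by
    refine ⟨?_, LipschitzWith.of_dist_le_mul fun u u' => ?_⟩
    · rw [div_lt_one (by positivity)]; exact lt_add_one K
    · refine (BoundedContinuousFunction.dist_le (by positivity)).2 fun t => ?_
      have h1 : ∀ s, ‖v s (e s • u s) - v s (e s • u' s)‖ ≤ (K * dist u u') * e s := by
        intro s
        have h2 := (hK s).dist_le_mul (e s • u s) (e s • u' s)
        rw [dist_eq_norm, dist_smul₀, Real.norm_of_nonneg (he0 s).le] at h2
        refine h2.trans ?_
        have h3 := u.dist_coe_le_dist (g := u') s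
        have : (K : ℝ) * (e s * dist (u s) (u' s)) ≤ K * (e s * dist u u') := by
          have := (he0 s).le
          gcongr
        linarith
      have h2 := norm_integral_le_of_norm_le_exp_abs hl0 h1 t
      rw [hNapp, hNapp, dist_eq_norm, ← smul_sub, add_sub_add_left_eq_sub,
        ← intervalIntegral.integral_sub ((hcont u).intervalIntegrable _ _)
          ((hcont u').intervalIntegrable _ _), norm_smul, norm_inv,
        Real.norm_of_nonneg (he0 t).le, inv_mul_le_iff₀ (he0 t)]
      refine h2.trans (le_of_eq ?_)
      change _ * e t = _
      push_cast
      rw [hl]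
      ring
  obtain ⟨u, hu, -⟩ := hN.exists_fixedPoint 0 (edist_ne_top _ _)
  have hγ : ∀ t, e t • u t = w + ∫ s in (0 : ℝ)..t, v s (e s • u s) := by
    intro t
    have h : u t = (e t)⁻¹ • (w + ∫ s in (0 : ℝ)..t, v s (e s • u s)) := by
      rw [← hNapp, hu]
    conv_lhs => rw [h]
    exact smul_inv_smul₀ (he0 t).ne' _
  refine ⟨fun t => e t • u t, by simpa using hγ 0, fun t => ?_⟩
  have h1 := (intervalIntegral.integral_hasDerivAt_right ((hcont u).intervalIntegrable 0 t)
    ((hcont u).stronglyMeasurableAtFilter _ _) (hcont u).continuousAt).const_add w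
  exact h1.congr_of_eventuallyEq (Eventually.of_forall hγ)

/-- A two-sided Grönwall inequality. -/
theorem norm_le_gronwallBound_abs {u u' : ℝ → E} {K ε T : ℝ} (hK : 0 ≤ K) (hε : 0 ≤ ε)
    (hu : ∀ t, HasDerivAt u (u' t) t) (hb : ∀ t ∈ Icc (-T) T, ‖u' t‖ ≤ K * ‖u t‖ + ε)
    {t : ℝ} (ht : t ∈ Icc (-T) T) : ‖u t‖ ≤ gronwallBound ‖u 0‖ K ε T := by
  have key : ∀ (u u' : ℝ → E), (∀ t, HasDerivAt u (u' t) t) →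
      (∀ t ∈ Icc (-T) T, ‖u' t‖ ≤ K * ‖u t‖ + ε) → ∀ t, 0 ≤ t → t ≤ T →
      ‖u t‖ ≤ gronwallBound ‖u 0‖ K ε T := by
    intro u u' hu hb t ht0 htT
    have h1 := norm_le_gronwallBound_of_norm_deriv_right_le (f := u) (f' := u') (a := 0) (b := T)
      (δ := ‖u 0‖) (K := K) (ε := ε)
      (fun t _ => (hu t).continuousAt.continuousWithinAt) (fun t _ => (hu t).hasDerivWithinAt)
      le_rfl (fun s hs => hb s ⟨by linarith [hs.1, hs.2], hs.2.le⟩) t ⟨ht0, htT⟩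
    refine h1.trans (gronwallBound_mono (norm_nonneg _) hε hK ?_)
    linarith
  rcases le_total 0 t with h | h
  · exact key u u' hu hb t h ht.2
  · have := key (fun t => u (-t)) (fun t => -u' (-t))
      (fun t => by
        simpa [Function.comp_def] using (hu (-t)).scomp t (hasDerivAt_neg t))
      (fun t ht => by simpa using hb (-t) ⟨by linarith [ht.2], by linarith [ht.1]⟩)
      (-t) (by linarith) (by linarith [ht.1])
    simpa using this

/-- The flow of a `C¹` Lipschitz vector field is globally defined and jointly `C¹`. -/
theorem exists_contDiff_flow [CompleteSpace E] {f : E → E} (hf : ContDiff ℝ 1 f) {K : ℝ≥0}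
    (hK : LipschitzWith K f) :
    ∃ Φ : ℝ → E → E, ContDiff ℝ 1 (fun q : ℝ × E => Φ q.1 q.2) ∧ (∀ w, Φ 0 w = w) ∧
      ∀ w t, HasDerivAt (fun t => Φ t w) (f (Φ t w)) t := by
  have hex : ∀ w, ∃ γ : ℝ → E, γ 0 = w ∧ ∀ t, HasDerivAt γ (f (γ t)) t := fun w =>
    exists_forall_hasDerivAt_of_lipschitz (v := fun _ => f)
      (hf.continuous.comp continuous_snd) (fun _ => hK) (fun _ => le_rfl) w
  choose φ hφ0 hφ using hex
  have hφc : ∀ w, Continuous (φ w) := fun w =>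
    continuous_iff_continuousAt.2 fun t => (hφ w t).continuousAt
  have hlip : ∀ T w w', ∀ t ∈ Icc (-T) T, ‖φ w' t - φ w t‖ ≤ ‖w' - w‖ * Real.exp (K * T) := by
    intro T w w' t ht
    have := norm_le_gronwallBound_abs (u := fun t => φ w' t - φ w t) K.coe_nonneg le_rfl
      (fun t => (hφ w' t).sub (hφ w t)) (T := T) (fun t _ => by
        simpa [dist_eq_norm] using hK.dist_le_mul (φ w' t) (φ w t)) ht
    simpa [hφ0, gronwallBound_ε0] using this
  have hev : ∀ (w : E) (T ε : ℝ), 0 < ε → ∀ᶠ w' in 𝓝 w, ∀ t ∈ Icc (-T) T,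
      ‖φ w' t - φ w t‖ ≤ ε := by
    intro w T ε hε
    have hc : ContinuousAt (fun w' => ‖w' - w‖ * Real.exp (K * T)) w := by fun_prop
    filter_upwards [hc.eventually (gt_mem_nhds (by simpa using hε))] with w' hw' t ht
    exact (hlip T w w' t ht).trans hw'.le
  have hφcont : Continuous fun q : ℝ × E => φ q.2 q.1 :=
    continuous_uncurry_of_forall_eventually_Icc (Ψ := fun t w => φ w t) hφc hev
  have hf' : Continuous (fderiv ℝ f) := hf.continuous_fderiv one_ne_zero
  have hf'b : ∀ x, ‖fderiv ℝ f x‖ ≤ K := fun x => norm_fderiv_le_of_lipschitz ℝ hK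
  -- `M w` solves the variational equation along the trajectory of `w`; it is the candidate for the
  -- derivative of the flow in the initial point.
  have hexM : ∀ w, ∃ M : ℝ → E →L[ℝ] E, M 0 = ContinuousLinearMap.id ℝ E ∧
      ∀ t, HasDerivAt M ((fderiv ℝ f (φ w t)).comp (M t)) t := fun w =>
    exists_forall_hasDerivAt_of_lipschitz
      (v := fun t (A : E →L[ℝ] E) => (fderiv ℝ f (φ w t)).comp A) (K := K) (C := 0)
      (((hf'.comp ((hφc w).comp continuous_fst))).clm_comp continuous_snd)
      (fun t => LipschitzWith.of_dist_le_mul fun A B => by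
        rw [dist_eq_norm, dist_eq_norm, ← ContinuousLinearMap.comp_sub]
        exact (ContinuousLinearMap.opNorm_comp_le _ _).trans (by gcongr; exact hf'b _))
      (fun t => by simp) _
  choose M hM0 hM using hexM
  have hMc : ∀ w, Continuous (M w) := fun w =>
    continuous_iff_continuousAt.2 fun t => (hM w t).continuousAt
  have hMev : ∀ (w : E) (T ε : ℝ), 0 < ε → ∀ᶠ w' in 𝓝 w, ∀ t ∈ Icc (-T) T,
      ‖M w' t - M w t‖ ≤ ε := by
    intro w T ε hε
    have hcg := (gronwallBound_continuous_ε 0 K T).continuousAt (x := 0)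
    have hg0 : gronwallBound 0 K 0 T = 0 := gronwallBound_ε0_δ0 _ _
    have hg : ∀ᶠ η in 𝓝[>] (0 : ℝ), gronwallBound 0 K η T < ε :=
      nhdsWithin_le_nhds (hcg.eventually (gt_mem_nhds (hg0.trans_lt hε)))
    obtain ⟨η, hη, hη0⟩ := (hg.and self_mem_nhdsWithin).exists
    replace hη0 : 0 < η := hη0
    -- The coefficients of the two variational equations are uniformly close over the compact time
    -- interval, so Grönwall applies with inhomogeneity `η`.
    have htube : ∀ᶠ w' in 𝓝 w, ∀ t ∈ Icc (-T) T,
        ‖(fderiv ℝ f (φ w' t) - fderiv ℝ f (φ w t)).comp (M w t)‖ < η := by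
      refine isCompact_Icc.eventually_forall_of_forall_eventually fun t _ => ?_
      have hc : Continuous fun z : E × ℝ =>
          ‖(fderiv ℝ f (φ z.1 z.2) - fderiv ℝ f (φ w z.2)).comp (M w z.2)‖ := by
        have h1 : Continuous fun z : E × ℝ => φ z.1 z.2 := hφcont.comp continuous_swap
        have h2 := (hφc w).comp (continuous_snd (X := E))
        have h3 := (hMc w).comp (continuous_snd (X := E))
        exact (((hf'.comp h1).sub (hf'.comp h2)).clm_comp h3).norm
      exact hc.continuousAt.eventually (gt_mem_nhds (by simpa using hη0))
    filter_upwards [htube] with w' hw' t ht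
    have := norm_le_gronwallBound_abs (u := fun t => M w' t - M w t) K.coe_nonneg hη0.le
      (fun t => (hM w' t).sub (hM w t)) (T := T) (fun t ht => by
        have h1 : (fderiv ℝ f (φ w' t)).comp (M w' t) - (fderiv ℝ f (φ w t)).comp (M w t)
            = (fderiv ℝ f (φ w' t)).comp (M w' t - M w t)
              + (fderiv ℝ f (φ w' t) - fderiv ℝ f (φ w t)).comp (M w t) := by
          rw [ContinuousLinearMap.comp_sub, ContinuousLinearMap.sub_comp]; abel
        rw [h1]
        refine (norm_add_le _ _).trans (add_le_add ?_ (hw' t ht).le)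
        exact (ContinuousLinearMap.opNorm_comp_le _ _).trans (by gcongr; exact hf'b _)) ht
    simp only [hM0, sub_self, norm_zero] at this
    exact this.trans hη.le
  have hMcont : Continuous fun q : ℝ × E => M q.2 q.1 :=
    continuous_uncurry_of_forall_eventually_Icc (Ψ := fun t w => M w t) hMc hMev
  have hderiv : ∀ w t, HasFDerivAt (fun w => φ w t) (M w t) w := by
    intro w t
    set T := |t|
    have htT : t ∈ Icc (-T) T := ⟨neg_abs_le t, le_abs_self t⟩
    rw [hasFDerivAt_iff_isLittleO, Asymptotics.isLittleO_iff]
    intro c hc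
    -- Linearity in the inhomogeneity lets `ε` below be chosen so that the final error is `c * (B /
    -- (B + 1)) * ‖w' - w‖`.
    have hlin : ∀ η, gronwallBound 0 K η T = η * gronwallBound 0 K 1 T := by
      intro η
      by_cases h : (K : ℝ) = 0
      · simp [h, gronwallBound_K0]
      · simp [gronwallBound_of_K_ne_0 h]; ring
    have hB : 0 ≤ gronwallBound 0 K 1 T := by
      have := gronwallBound_mono le_rfl zero_le_one K.coe_nonneg (abs_nonneg t : (0 : ℝ) ≤ |t|)
      rwa [gronwallBound_x0] at this
    set B := gronwallBound 0 K 1 T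
    set ε := c / ((B + 1) * Real.exp (K * T)) with hεdef
    have hε : 0 < ε := by positivity
    have htube : ∀ᶠ w' in 𝓝 w, ∀ z ∈ Icc (-T) T ×ˢ Icc (0 : ℝ) 1,
        ‖fderiv ℝ f (φ w z.1 + z.2 • (φ w' z.1 - φ w z.1)) - fderiv ℝ f (φ w z.1)‖ < ε := by
      refine (isCompact_Icc.prod isCompact_Icc).eventually_forall_of_forall_eventually
        fun z _ => ?_
      have hc : Continuous fun z : E × (ℝ × ℝ) => ‖fderiv ℝ f
          (φ w z.2.1 + z.2.2 • (φ z.1 z.2.1 - φ w z.2.1)) - fderiv ℝ f (φ w z.2.1)‖ := by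
        have h1 : Continuous fun z : E × (ℝ × ℝ) => φ z.1 z.2.1 :=
          hφcont.comp ((continuous_fst.comp continuous_snd).prodMk continuous_fst)
        have h2 : Continuous fun z : E × (ℝ × ℝ) => φ w z.2.1 :=
          (hφc w).comp (continuous_fst.comp continuous_snd)
        have h3 : Continuous fun z : E × (ℝ × ℝ) => z.2.2 := by fun_prop
        exact ((hf'.comp (h2.add (h3.smul (h1.sub h2)))).sub (hf'.comp h2)).norm
      exact hc.continuousAt.eventually (gt_mem_nhds (by simpa using hε))
    filter_upwards [htube] with w' hw'
    have hη0 : 0 ≤ ε * (‖w' - w‖ * Real.exp (K * T)) := by positivity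
    have := norm_le_gronwallBound_abs (u := fun t => φ w' t - φ w t - M w t (w' - w)) K.coe_nonneg hη0
      (fun t => ((hφ w' t).sub (hφ w t)).sub ((hM w t).clm_apply (hasDerivAt_const t (w' - w))))
      (T := T) (fun s hs => by
        have h1 : ‖f (φ w' s) - f (φ w s) - fderiv ℝ f (φ w s) (φ w' s - φ w s)‖
            ≤ ε * ‖φ w' s - φ w s‖ := by
          refine Convex.norm_image_sub_le_of_norm_hasFDerivWithin_le' (s := segment ℝ (φ w s) (φ w' s))
            (fun z _ => (hf.differentiable one_ne_zero z).hasFDerivAt.hasFDerivWithinAt)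
            (fun z hz => ?_) (convex_segment _ _) (left_mem_segment _ _ _) (right_mem_segment _ _ _)
          rw [segment_eq_image'] at hz
          obtain ⟨θ, hθ, rfl⟩ := hz
          exact (hw' (s, θ) ⟨hs, hθ⟩).le
        have h2 := mul_le_mul_of_nonneg_left (hlip T w w' s hs) hε.le
        -- The remainder `φ w' - φ w - M w (w' - w)` satisfies the variational equation up to the
        -- first-order Taylor error of `f`, which `h1` makes small relative to `‖w' - w‖`.
        have h3 : f (φ w' s) - f (φ w s)
            - (((fderiv ℝ f (φ w s)).comp (M w s)) (w' - w) + (M w s) 0)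
            = fderiv ℝ f (φ w s) (φ w' s - φ w s - M w s (w' - w))
              + (f (φ w' s) - f (φ w s) - fderiv ℝ f (φ w s) (φ w' s - φ w s)) := by
          simp only [map_sub, map_zero, ContinuousLinearMap.comp_apply]
          abel
        rw [h3]
        refine (norm_add_le _ _).trans (add_le_add ?_ (h1.trans h2))
        exact (ContinuousLinearMap.le_opNorm _ _).trans (by gcongr; exact hf'b _)) htT
    simp only [hφ0, hM0, ContinuousLinearMap.id_apply, sub_self, norm_zero] at this
    refine this.trans ?_
    rw [hlin]
    have h4 : ε * (‖w' - w‖ * Real.exp (K * T)) * B = c * (B / (B + 1)) * ‖w' - w‖ := by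
      rw [hεdef]; field_simp
    rw [h4]
    have h5 : B / (B + 1) ≤ 1 := (div_le_one (by positivity)).2 (by linarith)
    have h6 : c * (B / (B + 1)) ≤ c := mul_le_of_le_one_right hc.le h5
    gcongr
  refine ⟨fun t w => φ w t, ?_, hφ0, hφ⟩
  have hfc : Continuous fun q : ℝ × E => f (φ q.2 q.1) := hf.continuous.comp hφcont
  have hc1 : Continuous fun q : ℝ × E =>
      ContinuousLinearMap.toSpanSingleton ℝ (f (φ q.2 q.1)) :=
    (ContinuousLinearMap.toSpanSingletonCLE (𝕜 := ℝ) (E := E)).continuous.comp hfc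
  have hstrict : ∀ q : ℝ × E, HasStrictFDerivAt (fun q : ℝ × E => φ q.2 q.1)
      ((ContinuousLinearMap.toSpanSingleton ℝ (f (φ q.2 q.1))).coprod (M q.2 q.1)) q := by
    intro q
    exact hasStrictFDerivAt_uncurry_coprod (f := fun t w => φ w t)
      (f₁ := fun t w => ContinuousLinearMap.toSpanSingleton ℝ (f (φ w t)))
      (f₂ := fun t w => M w t)
      (Eventually.of_forall fun z => (hφ z.2 z.1).hasFDerivAt)
      (Eventually.of_forall fun z => hderiv z.2 z.1)
      hc1.continuousAt hMcont.continuousAt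
  refine contDiff_one_iff_hasFDerivAt.2 ⟨_, ?_, fun q => (hstrict q).hasFDerivAt⟩
  have := hc1.prodMk hMcont
  exact (ContinuousLinearMap.coprodEquivL (S := ℝ) (𝕜 := ℝ) (E := ℝ) (F := E) (G := E)).continuous.comp this

end Flow

/-! ### Replacing the potential outside a compact interval. -/

/-- A `C²` potential on the whole line that agrees with `V` on `[α, β]`, together with its
globally defined `C¹` Hamiltonian flow. -/
structure TruncatedFlow (V : ℝ → ℝ) (α β : ℝ) where
  pot : ℝ → ℝ
  flow : ℝ → ℝ × ℝ → ℝ × ℝ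
  contDiff_pot : ContDiff ℝ 2 pot
  pot_eq : EqOn pot V (Icc α β)
  deriv_pot_eq : EqOn (deriv pot) (deriv V) (Icc α β)
  contDiff_flow : ContDiff ℝ 1 fun q : ℝ × (ℝ × ℝ) => flow q.1 q.2
  flow_zero : ∀ w, flow 0 w = w
  isTrajectory : ∀ w, IsTrajectory univ pot fun t => flow t w

/-- Freezing `V''` at its endpoint values outside `[α, β]` and integrating twice keeps the potential
`C²` and makes its second derivative bounded, so the Hamiltonian field becomes globally Lipschitz.
-/
theorem exists_truncatedFlow {I : Set ℝ} {V : ℝ → ℝ} (hI : IsOpen I) (hV : ContDiffOn ℝ 2 V I)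
    {α β : ℝ} (hαβ : α ≤ β) (hsub : Icc α β ⊆ I) : Nonempty (TruncatedFlow V α β) := by
  have hV1 : ContDiffOn ℝ 1 (deriv V) I := hV.deriv_of_isOpen hI (by norm_num)
  have hV2 : ContinuousOn (deriv (deriv V)) I := hV1.continuousOn_deriv_of_isOpen hI le_rfl
  have hd1 : ∀ x ∈ I, HasDerivAt V (deriv V x) x := fun x hx =>
    ((hV.differentiableOn two_ne_zero).differentiableAt (hI.mem_nhds hx)).hasDerivAt
  have hd2 : ∀ x ∈ I, HasDerivAt (deriv V) (deriv (deriv V) x) x := fun x hx =>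
    ((hV1.differentiableOn one_ne_zero).differentiableAt (hI.mem_nhds hx)).hasDerivAt
  let h : ℝ → ℝ := fun x => deriv (deriv V) (projIcc α β hαβ x)
  have hh : Continuous h := (hV2.mono hsub).comp_continuous
    (continuous_subtype_val.comp continuous_projIcc) fun x => (projIcc α β hαβ x).2
  have hheq : ∀ x ∈ Icc α β, h x = deriv (deriv V) x := fun x hx => by
    simp only [h, projIcc_of_mem hαβ hx]
  obtain ⟨C, hC⟩ := isCompact_Icc.exists_bound_of_continuousOn (hV2.mono hsub)
  have hhb : ∀ x, ‖h x‖ ≤ C := fun x => hC _ (projIcc α β hαβ x).2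
  let g : ℝ → ℝ := fun x => deriv V α + ∫ y in α..x, h y
  have hg : ∀ x, HasDerivAt g (h x) x := fun x =>
    (intervalIntegral.integral_hasDerivAt_right (hh.intervalIntegrable _ _)
      (hh.stronglyMeasurableAtFilter _ _) hh.continuousAt).const_add _
  have hgc : Continuous g := continuous_iff_continuousAt.2 fun x => (hg x).continuousAt
  have hgeq : ∀ x ∈ Icc α β, g x = deriv V x := by
    intro x hx
    have hu : uIcc α x ⊆ Icc α β := by
      rw [uIcc_of_le hx.1]; exact Icc_subset_Icc_right hx.2
    have := intervalIntegral.integral_eq_sub_of_hasDerivAt (f := deriv V) (f' := h) (a := α) (b := x)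
      (fun y hy => by rw [hheq y (hu hy)]; exact hd2 y (hsub (hu hy))) (hh.intervalIntegrable _ _)
    simp only [g, this]; ring
  let G : ℝ → ℝ := fun x => V α + ∫ y in α..x, g y
  have hG : ∀ x, HasDerivAt G (g x) x := fun x =>
    (intervalIntegral.integral_hasDerivAt_right (hgc.intervalIntegrable _ _)
      (hgc.stronglyMeasurableAtFilter _ _) hgc.continuousAt).const_add _
  have hGeq : ∀ x ∈ Icc α β, G x = V x := by
    intro x hx
    have hu : uIcc α x ⊆ Icc α β := by
      rw [uIcc_of_le hx.1]; exact Icc_subset_Icc_right hx.2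
    have := intervalIntegral.integral_eq_sub_of_hasDerivAt (f := V) (f' := g) (a := α) (b := x)
      (fun y hy => by rw [hgeq y (hu hy)]; exact hd1 y (hsub (hu hy))) (hgc.intervalIntegrable _ _)
    simp only [G, this]; ring
  have hdG : deriv G = g := funext fun x => (hG x).deriv
  have hdg : deriv g = h := funext fun x => (hg x).deriv
  have hg1 : ContDiff ℝ 1 g :=
    contDiff_one_iff_deriv.2 ⟨fun x => (hg x).differentiableAt, by rwa [hdg]⟩
  have hG2 : ContDiff ℝ 2 G := by
    rw [show (2 : WithTop ℕ∞) = 1 + 1 by norm_num, contDiff_succ_iff_deriv]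
    exact ⟨fun x => (hG x).differentiableAt, by simp, by rwa [hdG]⟩
  have hglip : LipschitzWith C.toNNReal g :=
    lipschitzWith_of_nnnorm_deriv_le (fun x => (hg x).differentiableAt) fun x => by
      rw [hdg, ← NNReal.coe_le_coe, coe_nnnorm]
      exact (hhb x).trans (Real.le_coe_toNNReal C)
  have hflip : LipschitzWith (max 1 C.toNNReal) fun w : ℝ × ℝ => (w.2, -g w.1) := by
    refine LipschitzWith.prodMk LipschitzWith.prod_snd ?_
    have := (hglip.comp (LipschitzWith.prod_fst (α := ℝ) (β := ℝ))).neg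
    rwa [mul_one] at this
  obtain ⟨Φ, hΦ, hΦ0, hΦ'⟩ := exists_contDiff_flow
    (f := fun w : ℝ × ℝ => (w.2, -g w.1))
    (contDiff_snd.prodMk (hg1.comp contDiff_fst).neg) hflip
  exact ⟨⟨G, Φ, hG2, hGeq, fun x hx => by rw [hdG]; exact hgeq x hx, hΦ, hΦ0,
    fun w t => ⟨mem_univ _, by rw [hdG]; exact hΦ' w t⟩⟩⟩

theorem exists_Icc_of_isCompact {I S : Set ℝ} (hI : I.OrdConnected) (hS : IsCompact S)
    (hne : S.Nonempty) (hSI : S ⊆ I) : ∃ α β, α ≤ β ∧ S ⊆ Icc α β ∧ Icc α β ⊆ I ∧ α ∈ S ∧ β ∈ S := by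
  obtain ⟨α, hα, hα'⟩ := hS.exists_isLeast hne
  obtain ⟨β, hβ, hβ'⟩ := hS.exists_isGreatest hne
  exact ⟨α, β, hα' hβ, fun x hx => ⟨hα' hx, hβ' hx⟩, hI.out (hSI hα) (hSI hβ), hα, hβ⟩

theorem exists_Icc_mem_Ioo_of_Icc_subset {I : Set ℝ} (hI : IsOpen I) (hI' : I.OrdConnected)
    {α β : ℝ} (hαβ : α ≤ β) (hsub : Icc α β ⊆ I) :
    ∃ α' β', α' < α ∧ β < β' ∧ Icc α' β' ⊆ I := by
  obtain ⟨l, u, ⟨hl, hu⟩, hlu⟩ := mem_nhds_iff_exists_Ioo_subset.1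
    (hI.mem_nhds (hsub (left_mem_Icc.2 hαβ)))
  obtain ⟨l', u', ⟨hl', hu'⟩, hlu'⟩ := mem_nhds_iff_exists_Ioo_subset.1
    (hI.mem_nhds (hsub (right_mem_Icc.2 hαβ)))
  exact ⟨(l + α) / 2, (β + u') / 2, by linarith, by linarith,
    hI'.out (hlu ⟨by linarith, by linarith⟩) (hlu' ⟨by linarith, by linarith⟩)⟩

/-! ### Energy, uniqueness, turning points and symmetry of one-dimensional trajectories. -/

namespace IsTrajectory

variable {I : Set ℝ} {V : ℝ → ℝ} {γ γ' : ℝ → ℝ × ℝ}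

theorem mem (h : IsTrajectory I V γ) (t : ℝ) : (γ t).1 ∈ I := (h t).1

theorem hasDerivAt_fst (h : IsTrajectory I V γ) (t : ℝ) :
    HasDerivAt (fun t => (γ t).1) (γ t).2 t :=
  (hasFDerivAt_fst (p := γ t)).comp_hasDerivAt t (h t).2

theorem hasDerivAt_snd (h : IsTrajectory I V γ) (t : ℝ) :
    HasDerivAt (fun t => (γ t).2) (-deriv V (γ t).1) t :=
  (hasFDerivAt_snd (p := γ t)).comp_hasDerivAt t (h t).2

theorem continuous (h : IsTrajectory I V γ) : Continuous γ :=
  continuous_iff_continuousAt.2 fun t => (h t).2.continuousAt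

theorem continuous_fst (h : IsTrajectory I V γ) : Continuous fun t => (γ t).1 :=
  _root_.continuous_fst.comp h.continuous

theorem continuous_snd (h : IsTrajectory I V γ) : Continuous fun t => (γ t).2 :=
  _root_.continuous_snd.comp h.continuous

/-- Conservation of energy. -/
theorem hamiltonian1_eq (h : IsTrajectory I V γ) (hI : IsOpen I) (hV : ContDiffOn ℝ 2 V I)
    (t s : ℝ) : hamiltonian1 V (γ t) = hamiltonian1 V (γ s) := by
  have hd : ∀ t, HasDerivAt (fun t => hamiltonian1 V (γ t)) 0 t := by
    intro t
    have h1 : HasDerivAt V (deriv V (γ t).1) (γ t).1 :=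
      ((hV.differentiableOn two_ne_zero).differentiableAt (hI.mem_nhds (h.mem t))).hasDerivAt
    have h2 := (((h.hasDerivAt_snd t).pow 2).div_const 2).add (h1.comp t (h.hasDerivAt_fst t))
    refine h2.congr_deriv ?_
    push_cast
    ring
  exact is_const_of_deriv_eq_zero (fun t => (hd t).differentiableAt) (fun t => (hd t).deriv) t s

/-- Uniqueness of trajectories. -/
theorem eq_of_apply_eq (h : IsTrajectory I V γ) (h' : IsTrajectory I V γ') (hI : IsOpen I)
    (hI' : I.OrdConnected) (hV : ContDiffOn ℝ 2 V I) {t₀ : ℝ} (heq : γ t₀ = γ' t₀) : γ = γ' := by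
  funext t
  set a := min t t₀ - 1
  set b := max t t₀ + 1
  have ht : t ∈ Icc a b := ⟨by linarith [min_le_left t t₀], by linarith [le_max_left t t₀]⟩
  have ht0 : t₀ ∈ Ioo a b := ⟨by linarith [min_le_right t t₀], by linarith [le_max_right t t₀]⟩
  obtain ⟨α, β, -, hS, hsub, -, -⟩ := exists_Icc_of_isCompact hI'
    ((isCompact_Icc.image h.continuous_fst).union (isCompact_Icc.image h'.continuous_fst))
    (S := (fun t => (γ t).1) '' Icc a b ∪ (fun t => (γ' t).1) '' Icc a b)
    (Nonempty.inl ⟨_, mem_image_of_mem _ ht⟩) (by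
      rintro _ (⟨s, -, rfl⟩ | ⟨s, -, rfl⟩)
      · exact h.mem s
      · exact h'.mem s)
  have hV1 : ContDiffOn ℝ 1 (deriv V) I := hV.deriv_of_isOpen hI (by norm_num)
  obtain ⟨C, hC⟩ := isCompact_Icc.exists_bound_of_continuousOn
    ((hV1.continuousOn_deriv_of_isOpen hI le_rfl).mono hsub)
  have hK : LipschitzOnWith C.toNNReal (deriv V) (Icc α β) :=
    (convex_Icc α β).lipschitzOnWith_of_nnnorm_deriv_le
      (fun x hx => (hV1.differentiableOn one_ne_zero).differentiableAt (hI.mem_nhds (hsub hx)))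
      fun x hx => by
        rw [← NNReal.coe_le_coe, coe_nnnorm]
        exact (hC x hx).trans (Real.le_coe_toNNReal C)
  refine ODE_solution_unique_of_mem_Icc (v := fun _ w => (w.2, -deriv V w.1)) (K := max 1 C.toNNReal)
    (s := fun _ => Icc α β ×ˢ univ) (fun t _ => ?_) ht0
    h.continuous.continuousOn (fun t _ => (h t).2)
    (fun t ht => ⟨hS (Or.inl (mem_image_of_mem _ (Ioo_subset_Icc_self ht))), mem_univ _⟩)
    h'.continuous.continuousOn (fun t _ => (h' t).2)
    (fun t ht => ⟨hS (Or.inr (mem_image_of_mem _ (Ioo_subset_Icc_self ht))), mem_univ _⟩) heq ht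
  refine LipschitzOnWith.prodMk (LipschitzWith.prod_snd.lipschitzOnWith) ?_
  have := hK.comp (g := deriv V) (f := Prod.fst) (s := Icc α β ×ˢ (univ : Set ℝ))
    ((LipschitzWith.prod_fst (α := ℝ) (β := ℝ)).lipschitzOnWith) (fun w hw => hw.1)
  have h2 := this.neg
  rwa [mul_one] at h2

theorem comp_add (h : IsTrajectory I V γ) (a : ℝ) : IsTrajectory I V fun t => γ (t + a) :=
  fun t => ⟨h.mem _, (h (t + a)).2.comp_add_const t a⟩

theorem reverse (h : IsTrajectory I V γ) (a : ℝ) :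
    IsTrajectory I V fun t => ((γ (a - t)).1, -(γ (a - t)).2) := by
  refine fun t => ⟨h.mem _, ?_⟩
  have h1 := (h.hasDerivAt_fst (a - t)).scomp t ((hasDerivAt_id t).const_sub a)
  have h2 := ((h.hasDerivAt_snd (a - t)).scomp t ((hasDerivAt_id t).const_sub a)).neg
  convert h1.prodMk h2 using 1 <;> simp

/-- A trajectory is symmetric about each of its turning points. -/
theorem apply_reflect (h : IsTrajectory I V γ) (hI : IsOpen I) (hI' : I.OrdConnected)
    (hV : ContDiffOn ℝ 2 V I) {a : ℝ} (ha : (γ a).2 = 0) (t : ℝ) :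
    γ (2 * a - t) = ((γ t).1, -(γ t).2) := by
  have := (h.reverse (2 * a)).eq_of_apply_eq h hI hI' hV (t₀ := a) (by
    ext <;> simp [two_mul, ha])
  rw [← congrFun this t]
  simp

/-- The composition of the time reflections about `a` and `b` is the translation by `2 * (b - a)`.
-/
theorem periodic_of_turning (h : IsTrajectory I V γ) (hI : IsOpen I) (hI' : I.OrdConnected)
    (hV : ContDiffOn ℝ 2 V I) {a b : ℝ} (ha : (γ a).2 = 0) (hb : (γ b).2 = 0) :
    Function.Periodic γ (2 * (b - a)) := by
  intro t
  have h1 := h.apply_reflect hI hI' hV hb (2 * a - t)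
  rw [h.apply_reflect hI hI' hV ha t] at h1
  rw [show t + 2 * (b - a) = 2 * b - (2 * a - t) by ring, h1]
  simp

/-- A trajectory passing through an equilibrium is constant. -/
theorem eq_const_of_equilibrium (h : IsTrajectory I V γ) (hI : IsOpen I) (hI' : I.OrdConnected)
    (hV : ContDiffOn ℝ 2 V I) {a : ℝ} (ha : (γ a).2 = 0) (hd : deriv V (γ a).1 = 0) (t : ℝ) :
    γ t = γ a := by
  have hc : IsTrajectory I V fun _ => γ a := fun t => ⟨h.mem a, by
    exact (hasDerivAt_const t (γ a)).congr_deriv (by simp [ha, hd, Prod.ext_iff])⟩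
  exact congrFun (h.eq_of_apply_eq hc hI hI' hV (t₀ := a) rfl) t

/-- The positions of a periodic trajectory fill an interval, with turning points at both ends. -/
theorem exists_range_fst_eq_Icc (h : IsTrajectory I V γ) {T : ℝ} (hT : T ≠ 0)
    (hper : Function.Periodic γ T) :
    ∃ α β a b, α ≤ β ∧ range (fun t => (γ t).1) = Icc α β ∧ γ a = (α, 0) ∧ γ b = (β, 0) := by
  have hper1 : Function.Periodic (fun t => (γ t).1) T := fun t => by simp only [hper t]
  have hcomp : IsCompact (range fun t => (γ t).1) := hper1.compact_of_continuous hT h.continuous_fst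
  obtain ⟨-, ⟨a, rfl⟩, ha⟩ := hcomp.exists_isLeast (range_nonempty _)
  obtain ⟨-, ⟨b, rfl⟩, hb⟩ := hcomp.exists_isGreatest (range_nonempty _)
  refine ⟨_, _, a, b, ha (mem_range_self b), Subset.antisymm
    (fun x hx => ⟨ha hx, hb hx⟩) ?_, Prod.ext rfl ?_, Prod.ext rfl ?_⟩
  · exact (isPreconnected_range h.continuous_fst).ordConnected.out (mem_range_self a) (mem_range_self b)
  · have hmin : IsLocalMin (fun t => (γ t).1) a := Eventually.of_forall fun t => ha (mem_range_self t)
    exact hmin.hasDerivAt_eq_zero (h.hasDerivAt_fst a)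
  · have hmax : IsLocalMax (fun t => (γ t).1) b := Eventually.of_forall fun t => hb (mem_range_self t)
    exact hmax.hasDerivAt_eq_zero (h.hasDerivAt_fst b)

/-- Trajectories of lower energy starting at a position of a periodic trajectory remain inside. -/
theorem range_fst_subset_of_hamiltonian1_lt (h : IsTrajectory I V γ) (h' : IsTrajectory I V γ')
    (hI : IsOpen I) (hV : ContDiffOn ℝ 2 V I) {T : ℝ} (hT : T ≠ 0)
    (hper : Function.Periodic γ T) (hE : hamiltonian1 V (γ' 0) < hamiltonian1 V (γ 0))
    (h0 : (γ' 0).1 ∈ range fun t => (γ t).1) :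
    range (fun t => (γ' t).1) ⊆ range fun t => (γ t).1 := by
  obtain ⟨α, β, a, b, hαβ, hr, ha, hb⟩ := h.exists_range_fst_eq_Icc hT hper
  -- At a turning point of `γ` the potential equals the whole energy of `γ`, which exceeds that of
  -- `γ'`; the endpoints are barriers for `γ'`.
  have hne : ∀ c s, γ s = (c, 0) → c ∉ range fun t => (γ' t).1 := by
    rintro c s hs ⟨t, ht⟩
    have h1 := h.hamiltonian1_eq hI hV s 0
    have h2 := h'.hamiltonian1_eq hI hV t 0
    simp only [hamiltonian1, hs] at h1 h2 hE ht
    rw [ht] at h2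
    nlinarith [sq_nonneg (γ' t).2]
  have hconn := (isPreconnected_range h'.continuous_fst).ordConnected
  rw [hr] at h0 ⊢
  rintro _ ⟨t, rfl⟩
  by_contra hcon
  rw [mem_Icc, not_and_or, not_le, not_le] at hcon
  rcases hcon with hcon | hcon
  · exact hne α a ha (hconn.out (mem_range_self t) (mem_range_self 0) ⟨hcon.le, h0.1⟩)
  · exact hne β b hb (hconn.out (mem_range_self 0) (mem_range_self t) ⟨h0.2, hcon.le⟩)

end IsTrajectory

/-! ### Return times and flow boxes. -/

namespace TruncatedFlow

variable {I : Set ℝ} {V : ℝ → ℝ} {α β : ℝ} (F : TruncatedFlow V α β)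

theorem continuous_flow : Continuous fun q : ℝ × (ℝ × ℝ) => F.flow q.1 q.2 :=
  F.contDiff_flow.continuous

theorem isTrajectory_of_forall_mem (hsub : Icc α β ⊆ I) {w : ℝ × ℝ}
    (h : ∀ t, (F.flow t w).1 ∈ Icc α β) : IsTrajectory I V fun t => F.flow t w :=
  fun t => ⟨hsub (h t), by rw [← F.deriv_pot_eq (h t)]; exact (F.isTrajectory w t).2⟩

theorem eq_flow_of_isTrajectory_univ {γ : ℝ → ℝ × ℝ} (h : IsTrajectory univ F.pot γ) :
    γ = fun t => F.flow t (γ 0) :=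
  h.eq_of_apply_eq (F.isTrajectory _) isOpen_univ ordConnected_univ F.contDiff_pot.contDiffOn
    (t₀ := 0) (F.flow_zero _).symm

theorem eq_flow_of_isTrajectory {γ : ℝ → ℝ × ℝ} (h : IsTrajectory I V γ)
    (hmem : ∀ t, (γ t).1 ∈ Icc α β) : γ = fun t => F.flow t (γ 0) :=
  F.eq_flow_of_isTrajectory_univ fun t =>
    ⟨mem_univ _, by rw [F.deriv_pot_eq (hmem t)]; exact (h t).2⟩

theorem hamiltonian1_flow (t : ℝ) (w : ℝ × ℝ) :
    hamiltonian1 F.pot (F.flow t w) = hamiltonian1 F.pot w := by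
  have := (F.isTrajectory w).hamiltonian1_eq isOpen_univ F.contDiff_pot.contDiffOn t 0
  simpa [F.flow_zero] using this

theorem periodic_of_flow_eq {T : ℝ} {w : ℝ × ℝ} (h : F.flow T w = w) :
    Function.Periodic (fun t => F.flow t w) T := by
  intro t
  have := F.eq_flow_of_isTrajectory_univ ((F.isTrajectory w).comp_add T)
  simpa [h] using congrFun this t

/-- The return time to a section `{x = const}` is a `C¹` function of the momentum. -/
theorem exists_period_function {x s₀ T : ℝ} (hs : s₀ ≠ 0) (hT : F.flow T (x, s₀) = (x, s₀)) :
    ∃ τ : ℝ → ℝ, ContDiffAt ℝ 1 τ s₀ ∧ τ s₀ = T ∧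
      ∀ᶠ s in 𝓝 s₀, F.flow (τ s) (x, s) = (x, s) := by
  -- The implicit function theorem is applied to the position alone: its time derivative at the
  -- return is the momentum `s₀ ≠ 0`. The momentum is recovered afterwards from energy conservation.
  let f : ℝ × ℝ → ℝ := fun q => (F.flow q.2 (x, q.1)).1
  have hf : ContDiff ℝ 1 f :=
    contDiff_fst.comp (F.contDiff_flow.comp
      (contDiff_snd.prodMk (contDiff_const.prodMk contDiff_fst)))
  have hfu : ContDiffAt ℝ 1 f (s₀, T) := hf.contDiffAt
  have hd : fderiv ℝ f (s₀, T) (0, 1) = s₀ := by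
    have h1 : HasDerivAt (fun t => f (s₀, t)) (fderiv ℝ f (s₀, T) (0, 1)) T :=
      ((hf.differentiable one_ne_zero) (s₀, T)).hasFDerivAt.comp_hasDerivAt T
        ((hasDerivAt_const T s₀).prodMk (hasDerivAt_id T))
    have h2 := (F.isTrajectory (x, s₀)).hasDerivAt_fst T
    rw [hT] at h2
    exact h1.unique h2
  have hinv : (fderiv ℝ f (s₀, T) ∘L .inr ℝ ℝ ℝ).IsInvertible := by
    refine ⟨ContinuousLinearEquiv.unitsEquivAut ℝ (Units.mk0 s₀ hs), ?_⟩
    ext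
    simp [hd]
  refine ⟨hfu.implicitFunction one_ne_zero hinv, hfu.contDiffAt_implicitFunction one_ne_zero hinv,
    hfu.implicitFunction_apply_self one_ne_zero hinv, ?_⟩
  set τ := hfu.implicitFunction one_ne_zero hinv
  have hτ0 : τ s₀ = T := hfu.implicitFunction_apply_self one_ne_zero hinv
  have hτc : ContinuousAt τ s₀ := (hfu.contDiffAt_implicitFunction one_ne_zero hinv).continuousAt
  have h1 : ContinuousAt (fun s => (F.flow (τ s) (x, s)).2 + s) s₀ := by
    have : ContinuousAt (fun s => F.flow (τ s) (x, s)) s₀ :=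
      (F.continuous_flow.continuousAt).comp (hτc.prodMk (continuousAt_const.prodMk continuousAt_id))
    exact (continuousAt_snd.comp this).add continuousAt_id
  have h2 := h1.eventually_ne (y := 0) (by
    simp only [hτ0, hT]
    exact fun h => hs (by linarith))
  filter_upwards [hfu.eventually_apply_implicitFunction one_ne_zero hinv, h2] with s hs1 hs2
  have h3 : (F.flow (τ s) (x, s)).1 = x := by
    have : f (s, τ s) = f (s₀, T) := hs1
    simpa [f, hT] using this
  refine Prod.ext h3 ?_
  have h4 := F.hamiltonian1_flow (τ s) (x, s)
  simp only [hamiltonian1, h3] at h4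
  -- Energy fixes the returning momentum up to sign; the first factor is close to `2 * s₀`, which
  -- rules out the sign change.
  have h5 : ((F.flow (τ s) (x, s)).2 + s) * ((F.flow (τ s) (x, s)).2 - s) = 0 := by nlinarith
  have := (mul_eq_zero.1 h5).resolve_left hs2
  simp only
  linarith

/-- Flow box at a point of nonzero momentum. -/
theorem map_flow_nhds {x s : ℝ} (hs : s ≠ 0) :
    map (fun q : ℝ × ℝ => F.flow q.1 (x, q.2)) (𝓝 (0, s)) = 𝓝 (x, s) := by
  have hc : ContDiff ℝ 1 fun q : ℝ × ℝ => F.flow q.1 (x, q.2) :=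
    F.contDiff_flow.comp (contDiff_fst.prodMk (contDiff_const.prodMk contDiff_snd))
  have hstrict := hc.contDiffAt (x := (0, s)) |>.hasStrictFDerivAt one_ne_zero
  set L := fderiv ℝ (fun q : ℝ × ℝ => F.flow q.1 (x, q.2)) (0, s)
  -- The columns of the differential are the Hamiltonian field, whose position component is `s ≠ 0`,
  -- and the momentum direction; hence it is onto.
  have h1 : L (1, 0) = (s, -deriv F.pot x) := by
    have := hstrict.hasFDerivAt.comp_hasDerivAt (0 : ℝ)
      ((hasDerivAt_id (0 : ℝ)).prodMk (hasDerivAt_const (0 : ℝ) s))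
    have h2 := (F.isTrajectory (x, s) 0).2
    simp only [F.flow_zero] at h2
    exact this.unique h2
  have h2 : L (0, 1) = (0, 1) := by
    have := hstrict.hasFDerivAt.comp_hasDerivAt s
      ((hasDerivAt_const s (0 : ℝ)).prodMk (hasDerivAt_id s))
    have h2 := (hasDerivAt_const s x).prodMk (hasDerivAt_id s)
    simp only [Function.comp_def, F.flow_zero] at this
    exact this.unique h2
  have hsurj : (L : ℝ × ℝ →L[ℝ] ℝ × ℝ).range = ⊤ := by
    rw [LinearMap.range_eq_top]
    rintro ⟨a, b⟩
    refine ⟨(a / s, b + a / s * deriv F.pot x), ?_⟩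
    have h3 : ((a / s, b + a / s * deriv F.pot x) : ℝ × ℝ)
        = (a / s) • (1, 0) + (b + a / s * deriv F.pot x) • (0, 1) := by simp
    rw [h3]
    simp only [ContinuousLinearMap.coe_coe, map_add, map_smul, h1, h2]
    ext
    · simp [hs]
    · simp
  have := hstrict.map_nhds_eq_of_surj hsurj
  simpa [F.flow_zero] using this

end TruncatedFlow

/-- Near a periodic trajectory of nonzero initial momentum all trajectories are periodic, with a
period that is a `C¹` function of the momentum. -/
theorem IsTrajectory.exists_period_family {I : Set ℝ} {V : ℝ → ℝ} (hI : IsOpen I)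
    (hI' : I.OrdConnected) (hV : ContDiffOn ℝ 2 V I) {γ : ℝ → ℝ × ℝ} (h : IsTrajectory I V γ)
    {T x s₀ : ℝ} (hT : 0 < T) (hper : Function.Periodic γ T) (h0 : γ 0 = (x, s₀)) (hs : s₀ ≠ 0) :
    ∃ (Φ : ℝ → ℝ × ℝ → ℝ × ℝ) (τ : ℝ → ℝ),
      (Continuous fun q : ℝ × (ℝ × ℝ) => Φ q.1 q.2) ∧
      (∀ s, s ≠ 0 → map (fun q : ℝ × ℝ => Φ q.1 (x, q.2)) (𝓝 (0, s)) = 𝓝 (x, s)) ∧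
      ContDiffAt ℝ 1 τ s₀ ∧ τ s₀ = T ∧
      ∀ᶠ s in 𝓝 s₀, 0 < τ s ∧ Φ 0 (x, s) = (x, s) ∧ IsTrajectory I V (fun t => Φ t (x, s)) ∧
        Function.Periodic (fun t => Φ t (x, s)) (τ s) := by
  obtain ⟨α, β, a, b, hαβ, hr, ha, hb⟩ := h.exists_range_fst_eq_Icc hT.ne' hper
  have hsub : Icc α β ⊆ I := by
    rw [← hr]; rintro _ ⟨t, rfl⟩; exact h.mem t
  -- The margin keeps nearby trajectories in the region of agreement up to time `T + 1`; as `τ s < T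
  -- + 1`, this covers a full period and so all times.
  obtain ⟨α', β', hα', hβ', hsub'⟩ := exists_Icc_mem_Ioo_of_Icc_subset hI hI' hαβ hsub
  obtain ⟨F⟩ := exists_truncatedFlow hI hV (by linarith : α' ≤ β') hsub'
  have hmem : ∀ t, (γ t).1 ∈ Icc α β := fun t => hr ▸ mem_range_self t
  have hγ : ∀ t, γ t = F.flow t (x, s₀) := fun t => by
    rw [← h0]
    exact congrFun (F.eq_flow_of_isTrajectory h fun t =>
      ⟨hα'.le.trans (hmem t).1, (hmem t).2.trans hβ'.le⟩) t
  have hret : F.flow T (x, s₀) = (x, s₀) := by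
    rw [← hγ, ← h0]; simpa using hper 0
  obtain ⟨τ, hτ, hτT, hτper⟩ := F.exists_period_function hs hret
  refine ⟨F.flow, τ, F.continuous_flow, fun s hs => F.map_flow_nhds hs, hτ, hτT, ?_⟩
  have htube : ∀ᶠ s in 𝓝 s₀, ∀ t ∈ Icc 0 (T + 1), (F.flow t (x, s)).1 ∈ Ioo α' β' := by
    refine isCompact_Icc.eventually_forall_of_forall_eventually fun t _ => ?_
    have hc : Continuous fun z : ℝ × ℝ => (F.flow z.2 (x, z.1)).1 :=
      _root_.continuous_fst.comp (F.continuous_flow.comp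
        (_root_.continuous_snd.prodMk (continuous_const.prodMk _root_.continuous_fst)))
    refine hc.continuousAt.eventually (Ioo_mem_nhds ?_ ?_)
    · simp only [← hγ]; exact hα'.trans_le (hmem t).1
    · simp only [← hγ]; exact (hmem t).2.trans_lt hβ'
  have hτ1 : ∀ᶠ s in 𝓝 s₀, τ s ∈ Ioo 0 (T + 1) :=
    hτ.continuousAt.eventually (Ioo_mem_nhds (by rwa [hτT]) (by rw [hτT]; linarith))
  filter_upwards [htube, hτ1, hτper] with s h1 h2 h3
  have hp := F.periodic_of_flow_eq h3
  refine ⟨h2.1, F.flow_zero _, F.isTrajectory_of_forall_mem hsub' fun t => ?_, hp⟩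
  obtain ⟨t', ht', he⟩ := hp.exists_mem_Ico₀ h2.1 t
  rw [he]
  exact Ioo_subset_Icc_self (h1 t' ⟨ht'.1, by linarith [ht'.2, h2.2]⟩)

/-! ### From one periodic trajectory to a global well. -/

/-- The positive momenta `s` for which the trajectory through `(x₀, s)` is `T`-periodic. -/
def periodicMomenta (I : Set ℝ) (V : ℝ → ℝ) (x₀ T : ℝ) : Set ℝ :=
  {s | 0 < s ∧ ∃ γ, IsTrajectory I V γ ∧ γ 0 = (x₀, s) ∧ Function.Periodic γ T}

/-- `V` is a single well on `I` with bottom `x₀` all of whose trajectories are `T`-periodic. -/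
structure IsPeriodicWell (I : Set ℝ) (V : ℝ → ℝ) (x₀ T : ℝ) : Prop where
  mem : x₀ ∈ I
  deriv_eq_zero : deriv V x₀ = 0
  pos : 0 < T
  exists_orbit : ∀ w : ℝ × ℝ, w.1 ∈ I → w ≠ (x₀, 0) → ∃ s, 0 < s ∧ ∃ γ, IsTrajectory I V γ ∧
    γ 0 = (x₀, s) ∧ Function.Periodic γ T ∧ ∃ t, γ t = w
  deriv_ne_zero : ∀ c ∈ I, c ≠ x₀ → deriv V c ≠ 0
  lt : ∀ c ∈ I, c ≠ x₀ → V x₀ < V c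
  exists_Icc : ∀ E, ∃ α β, α ≤ β ∧ Icc α β ⊆ I ∧ ∀ x ∈ I, V x ≤ E → x ∈ Icc α β

section Well

variable {I : Set ℝ} {V : ℝ → ℝ} {x₀ T : ℝ}

/-- The blow-up at finite endpoints keeps limit points inside `I`; the window `[a, b]` takes the
place of any condition at infinity. -/
theorem isCompact_sublevel (hV : ContinuousOn V I) (hI : IsOpen I)
    (hend : ∀ c ∈ frontier I, Tendsto V (𝓝[I] c) atTop) (a b E : ℝ) :
    IsCompact {x | x ∈ I ∧ x ∈ Icc a b ∧ V x ≤ E} := by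
  refine isCompact_Icc.of_isClosed_subset (isClosed_of_closure_subset fun c hc => ?_)
    (fun x hx => hx.2.1 : _ ⊆ Icc a b)
  have hcab : c ∈ Icc a b := by
    have := closure_mono (fun x hx => hx.2.1 : {x | x ∈ I ∧ x ∈ Icc a b ∧ V x ≤ E} ⊆ Icc a b) hc
    rwa [isClosed_Icc.closure_eq] at this
  have hfr : ∃ᶠ x in 𝓝[I] c, V x ≤ E := by
    rw [frequently_nhdsWithin_iff]
    exact (mem_closure_iff_frequently.1 hc).mono fun x hx => ⟨hx.2.2, hx.1⟩
  by_cases hcI : c ∈ I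
  · exact ⟨hcI, hcab, le_of_tendsto_of_frequently (hV c hcI) hfr⟩
  · exfalso
    have hcf : c ∈ frontier I := by
      rw [hI.frontier_eq]
      exact ⟨closure_mono (fun x hx => hx.1) hc, hcI⟩
    obtain ⟨x, hx, hx'⟩ := (hfr.and_eventually ((hend c hcf).eventually_gt_atTop E)).exists
    exact absurd hx (not_le.2 hx')

/-- Once the trajectories share one compact interval, a single truncated flow describes them all,
and both confinement and `T`-periodicity are closed conditions on the momentum. -/
theorem mem_periodicMomenta_of_frequently (hI : IsOpen I) (hV : ContDiffOn ℝ 2 V I) {α β s : ℝ}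
    (hαβ : α ≤ β) (hsub : Icc α β ⊆ I) (hs : 0 < s)
    (hfr : ∃ᶠ s' in 𝓝 s, ∃ γ, IsTrajectory I V γ ∧ γ 0 = (x₀, s') ∧ Function.Periodic γ T ∧
      ∀ t, (γ t).1 ∈ Icc α β) :
    s ∈ periodicMomenta I V x₀ T := by
  obtain ⟨F⟩ := exists_truncatedFlow hI hV hαβ hsub
  have hc : ∀ t, Continuous fun s => F.flow t (x₀, s) := fun t =>
    F.continuous_flow.comp (continuous_const.prodMk (continuous_const.prodMk continuous_id))
  have hcl : IsClosed {s | ∀ t, (F.flow t (x₀, s)).1 ∈ Icc α β ∧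
      F.flow (t + T) (x₀, s) = F.flow t (x₀, s)} := by
    simp only [ofPred_forall, ofPred_and]
    exact isClosed_iInter fun t => (isClosed_Icc.preimage (continuous_fst.comp (hc t))).inter
      (isClosed_eq (hc (t + T)) (hc t))
  have hmem := hcl.closure_eq ▸ mem_closure_iff_frequently.2 (hfr.mono (by
    rintro s' ⟨γ, hγ, h0, hper, hγm⟩ t
    have h1 := F.eq_flow_of_isTrajectory hγ hγm
    rw [h0] at h1
    have h2 := hper t
    have h3 := hγm t
    rw [h1] at h2 h3
    exact ⟨h3, h2⟩))
  exact ⟨hs, _, F.isTrajectory_of_forall_mem hsub fun t => (hmem t).1, F.flow_zero _,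
    fun t => (hmem t).2⟩

theorem range_fst_subset_of_lt (hI : IsOpen I) (hV : ContDiffOn ℝ 2 V I) {γ γ' : ℝ → ℝ × ℝ}
    {s s' : ℝ} (hT : 0 < T) (h : IsTrajectory I V γ) (h' : IsTrajectory I V γ')
    (h0 : γ 0 = (x₀, s)) (h0' : γ' 0 = (x₀, s')) (hper : Function.Periodic γ T)
    (hs' : 0 < s') (hss : s' < s) :
    range (fun t => (γ' t).1) ⊆ range fun t => (γ t).1 := by
  refine h.range_fst_subset_of_hamiltonian1_lt h' hI hV hT.ne' hper ?_ ⟨0, by simp [h0, h0']⟩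
  simp only [hamiltonian1, h0, h0']
  nlinarith

theorem exists_Icc_range_fst {γ : ℝ → ℝ × ℝ} (hT : 0 < T) (h : IsTrajectory I V γ)
    (hper : Function.Periodic γ T) :
    ∃ α β, α ≤ β ∧ Icc α β ⊆ I ∧ range (fun t => (γ t).1) = Icc α β := by
  obtain ⟨α, β, -, -, hαβ, hr, -, -⟩ := h.exists_range_fst_eq_Icc hT.ne' hper
  refine ⟨α, β, hαβ, ?_, hr⟩
  rw [← hr]
  rintro _ ⟨t, rfl⟩
  exact h.mem t

/-- Connectedness of `(0, s₁]`: slower periodic trajectories are confined to the range of the one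
with momentum `s₁`, so the set is closed there as well as open. -/
theorem periodicMomenta_lower (hI : IsOpen I) (hV : ContDiffOn ℝ 2 V I) (hT : 0 < T)
    (hopen : IsOpen (periodicMomenta I V x₀ T)) {s s₁ : ℝ} (hs₁ : s₁ ∈ periodicMomenta I V x₀ T)
    (hs : s ∈ Ioc 0 s₁) : s ∈ periodicMomenta I V x₀ T := by
  obtain ⟨hs₁0, γ, hγ, hγ0, hper⟩ := hs₁
  obtain ⟨α, β, hαβ, hsub, hr⟩ := exists_Icc_range_fst hT hγ hper
  have hs₁ : s₁ ∈ periodicMomenta I V x₀ T := ⟨hs₁0, γ, hγ, hγ0, hper⟩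
  refine isPreconnected_Ioc.subset_of_closure_inter_subset hopen
    ⟨s₁, ⟨hs₁0, le_rfl⟩, hs₁⟩ ?_ hs
  rintro s ⟨hcl, hs0, hss⟩
  rcases hss.eq_or_lt with rfl | hlt
  · exact hs₁
  refine mem_periodicMomenta_of_frequently hI hV hαβ hsub hs0 ?_
  refine ((mem_closure_iff_frequently.1 hcl).and_eventually (gt_mem_nhds hlt)).mono ?_
  rintro s' ⟨⟨hs'0, γ', hγ', hγ'0, hper'⟩, hlt'⟩
  refine ⟨γ', hγ', hγ'0, hper', fun t => ?_⟩
  rw [← hr]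
  exact range_fst_subset_of_lt hI hV hT hγ hγ' hγ0 hγ'0 hper hs'0 hlt' (mem_range_self t)

/-- Each position on a `T`-periodic trajectory other than the bottom is a turning point. -/
theorem exists_turning (hI : IsOpen I) (hV : ContDiffOn ℝ 2 V I) (hT : 0 < T)
    (hx₀ : deriv V x₀ = 0) (hopen : IsOpen (periodicMomenta I V x₀ T))
    {γ : ℝ → ℝ × ℝ} {s₁ c : ℝ} (hs₁ : 0 < s₁) (hγ : IsTrajectory I V γ) (hγ0 : γ 0 = (x₀, s₁))
    (hper : Function.Periodic γ T) (hc : c ∈ range fun t => (γ t).1) (hcx : c ≠ x₀) :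
    ∃ s, 0 < s ∧ s ≤ s₁ ∧ ∃ γ', IsTrajectory I V γ' ∧ γ' 0 = (x₀, s) ∧ Function.Periodic γ' T ∧
      ∃ t, γ' t = (c, 0) := by
  obtain ⟨α, β, hαβ, hsub, hr⟩ := exists_Icc_range_fst hT hγ hper
  obtain ⟨F⟩ := exists_truncatedFlow hI hV hαβ hsub
  have hx₀m : x₀ ∈ Icc α β := hr ▸ ⟨0, by simp [hγ0]⟩
  have hfl : ∀ s ∈ Ioc 0 s₁, (∀ t, (F.flow t (x₀, s)).1 ∈ Icc α β) ∧
      Function.Periodic (fun t => F.flow t (x₀, s)) T := by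
    rintro s ⟨hs0, hss⟩
    obtain ⟨γ', hγ', hγ'0, hper', hm⟩ : ∃ γ', IsTrajectory I V γ' ∧ γ' 0 = (x₀, s) ∧
        Function.Periodic γ' T ∧ ∀ t, (γ' t).1 ∈ Icc α β := by
      rcases hss.eq_or_lt with rfl | hlt
      · exact ⟨γ, hγ, hγ0, hper, fun t => hr ▸ mem_range_self t⟩
      · obtain ⟨-, γ', hγ', hγ'0, hper'⟩ :=
          periodicMomenta_lower hI hV hT hopen ⟨hs₁, γ, hγ, hγ0, hper⟩ ⟨hs0, hss⟩
        refine ⟨γ', hγ', hγ'0, hper', fun t => ?_⟩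
        rw [← hr]
        exact range_fst_subset_of_lt hI hV hT hγ hγ' hγ0 hγ'0 hper hs0 hlt (mem_range_self t)
    have h1 := F.eq_flow_of_isTrajectory hγ' hm
    rw [hγ'0] at h1
    rw [← h1]
    refine ⟨fun t => ?_, hper'⟩
    have := hm t
    rwa [h1] at this
  -- The factor `σ` has the sign of `c - x₀`, so one argument about maxima handles both sides of the
  -- bottom.
  obtain ⟨σ, hσ⟩ : ∃ σ : ℝ, 0 < σ * (c - x₀) := ⟨c - x₀, mul_self_pos.2 (sub_ne_zero.2 hcx)⟩
  have hσ0 : σ ≠ 0 := by rintro rfl; simp at hσ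
  -- The extreme scaled position over a period depends continuously on `s`, is `σ * x₀` at the
  -- equilibrium and at least `σ * c` at `s₁`. At an intermediate value `σ * c` the maximum is
  -- attained, with zero momentum.
  let k : ℝ → ℝ := fun s => sSup ((fun t => σ * (F.flow t (x₀, s)).1) '' Icc 0 T)
  have hcont : Continuous fun q : ℝ × ℝ => σ * (F.flow q.2 (x₀, q.1)).1 :=
    continuous_const.mul (continuous_fst.comp (F.continuous_flow.comp
      (continuous_snd.prodMk (continuous_const.prodMk continuous_fst))))
  have hk : Continuous k := isCompact_Icc.continuous_sSup
    (f := fun s t => σ * (F.flow t (x₀, s)).1) hcont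
  have hct : ∀ s, ContinuousOn (fun t => σ * (F.flow t (x₀, s)).1) (Icc 0 T) := fun s =>
    (hcont.comp (continuous_const.prodMk continuous_id)).continuousOn
  have hk0 : k 0 = σ * x₀ := by
    have h1 : ∀ t, F.flow t (x₀, 0) = (x₀, 0) := by
      intro t
      have := (F.isTrajectory (x₀, 0)).eq_const_of_equilibrium isOpen_univ ordConnected_univ
        F.contDiff_pot.contDiffOn (a := 0) (by simp [F.flow_zero])
        (by simp only [F.flow_zero]; rw [F.deriv_pot_eq hx₀m, hx₀]) t
      simpa [F.flow_zero] using this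
    have h2 : (fun t => σ * (F.flow t (x₀, 0)).1) '' Icc 0 T = {σ * x₀} := by
      simp only [h1]
      exact (nonempty_Icc.2 hT.le).image_const _
    simp only [k, h2, csSup_singleton]
  have hk1 : σ * c ≤ k s₁ := by
    obtain ⟨t, ht⟩ := hc
    obtain ⟨t', ht', he⟩ := hper.exists_mem_Ico₀ hT t
    have h1 := F.eq_flow_of_isTrajectory hγ (fun t => hr ▸ mem_range_self t)
    rw [hγ0] at h1
    refine le_csSup (isCompact_Icc.bddAbove_image (hct s₁)) ⟨t', Ico_subset_Icc_self ht', ?_⟩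
    simp only at ht ⊢
    rw [← ht, he, h1]
  obtain ⟨s, hs, hks⟩ := intermediate_value_Icc hs₁.le hk.continuousOn
    (show σ * c ∈ Icc (k 0) (k s₁) from ⟨by rw [hk0]; nlinarith, hk1⟩)
  have hs0 : 0 < s := by
    refine hs.1.lt_of_ne ?_
    rintro rfl
    rw [hk0] at hks
    nlinarith
  obtain ⟨hm, hp⟩ := hfl s ⟨hs0, hs.2⟩
  obtain ⟨t, ht, htk, htmax⟩ := isCompact_Icc.exists_sSup_image_eq_and_ge (nonempty_Icc.2 hT.le)
    (hct s)
  have hXt : σ * (F.flow t (x₀, s)).1 = σ * c := by rw [← htk]; exact hks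
  refine ⟨s, hs0, hs.2, _, F.isTrajectory_of_forall_mem hsub hm, F.flow_zero _, hp, t,
    Prod.ext (mul_left_cancel₀ hσ0 hXt) ?_⟩
  have hmax : IsLocalMax (fun t => σ * (F.flow t (x₀, s)).1) t := Eventually.of_forall fun r => by
    obtain ⟨r', hr', he⟩ := hp.exists_mem_Ico₀ hT r
    simp only [he]
    exact htmax r' (Ico_subset_Icc_self hr')
  have := hmax.hasDerivAt_eq_zero (((F.isTrajectory (x₀, s)).hasDerivAt_fst t).const_mul σ)
  exact (mul_eq_zero.1 this).resolve_left hσ0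

theorem potential_eq_of_turning (hI : IsOpen I) (hV : ContDiffOn ℝ 2 V I) {γ : ℝ → ℝ × ℝ}
    {s c t : ℝ} (hγ : IsTrajectory I V γ) (hγ0 : γ 0 = (x₀, s)) (ht : γ t = (c, 0)) :
    V c = s ^ 2 / 2 + V x₀ := by
  have := hγ.hamiltonian1_eq hI hV t 0
  simpa [hamiltonian1, hγ0, ht] using this

/-- Connectedness of `(0, ∞)`. At a limit momentum `s` above all those known, the fixed period
bounds the excursion of the approximating trajectories, and their energies keep them away from
finite endpoints, so the limit is again periodic. -/
theorem periodicMomenta_eq_Ioi (hI : IsOpen I) (hI' : I.OrdConnected) (hV : ContDiffOn ℝ 2 V I)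
    (hend : ∀ c ∈ frontier I, Tendsto V (𝓝[I] c) atTop)
    (hT : 0 < T) (hx₀ : deriv V x₀ = 0) (hopen : IsOpen (periodicMomenta I V x₀ T))
    (hne : (periodicMomenta I V x₀ T).Nonempty) : periodicMomenta I V x₀ T = Ioi 0 := by
  refine Subset.antisymm (fun s hs => hs.1) ?_
  obtain ⟨s₂, hs₂⟩ := hne
  refine isPreconnected_Ioi.subset_of_closure_inter_subset hopen ⟨s₂, hs₂.1, hs₂⟩ ?_
  rintro s ⟨hcl, hs0⟩
  replace hs0 : 0 < s := hs0
  by_cases hex : ∃ s₁ ∈ periodicMomenta I V x₀ T, s ≤ s₁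
  · obtain ⟨s₁, hs₁, hle⟩ := hex
    exact periodicMomenta_lower hI hV hT hopen hs₁ ⟨hs0, hle⟩
  push Not at hex
  set E := s ^ 2 / 2 + V x₀
  -- The radius is speed times period: each visited position is `x₀` or a turning point of a
  -- periodic trajectory, so `V` is at least `V x₀` there and energy bounds the speed by `s`.
  set S := {x | x ∈ I ∧ x ∈ Icc (x₀ - s * T) (x₀ + s * T) ∧ V x ≤ E}
  have hSc : IsCompact S := isCompact_sublevel hV.continuousOn hI hend _ _ _
  have key : ∀ s' γ, 0 < s' → s' < s → IsTrajectory I V γ → γ 0 = (x₀, s') →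
      Function.Periodic γ T → ∀ t, (γ t).1 ∈ S := by
    intro s' γ hs' hlt hγ hγ0 hper t
    have hen : ∀ t, (γ t).2 ^ 2 / 2 + V (γ t).1 = s' ^ 2 / 2 + V x₀ := fun t => by
      simpa [hamiltonian1, hγ0] using hγ.hamiltonian1_eq hI hV t 0
    have hVge : ∀ t, V x₀ ≤ V (γ t).1 := by
      intro t
      by_cases hcx : (γ t).1 = x₀
      · rw [hcx]
      · obtain ⟨r, hr, -, γ', hγ', hγ'0, -, u, hu⟩ := exists_turning hI hV hT hx₀ hopen hs' hγ
          hγ0 hper (mem_range_self t) hcx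
        have := potential_eq_of_turning hI hV hγ' hγ'0 hu
        nlinarith
    have hP : ∀ t, ‖(γ t).2‖ ≤ s := fun t => by
      rw [Real.norm_eq_abs]
      exact abs_le_of_sq_le_sq (by nlinarith [hen t, hVge t]) hs0.le
    obtain ⟨t', ht', he⟩ := hper.exists_mem_Ico₀ hT t
    have h1 := convex_univ.norm_image_sub_le_of_norm_hasDerivWithin_le (C := s)
      (fun t _ => (hγ.hasDerivAt_fst t).hasDerivWithinAt) (fun t _ => hP t)
      (mem_univ 0) (mem_univ t')
    simp only [hγ0, sub_zero, Real.norm_eq_abs, abs_of_nonneg ht'.1] at h1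
    have h2 : s * t' ≤ s * T := by nlinarith [ht'.2]
    refine ⟨hγ.mem t, ?_, ?_⟩
    · rw [he]
      have := abs_le.1 (h1.trans h2)
      exact ⟨by linarith [this.1], by linarith [this.2]⟩
    · have := hen t
      simp only [E]
      nlinarith [sq_nonneg (γ t).2]
  have hfr : ∃ᶠ s' in 𝓝 s, ∃ γ, 0 < s' ∧ s' < s ∧ IsTrajectory I V γ ∧ γ 0 = (x₀, s') ∧
      Function.Periodic γ T :=
    (mem_closure_iff_frequently.1 hcl).mono fun s' hs' =>
      let ⟨h0, γ, h1, h2, h3⟩ := hs'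
      ⟨γ, h0, hex s' hs', h1, h2, h3⟩
  have hSne : S.Nonempty := by
    obtain ⟨s', γ, h0, hlt, h1, h2, h3⟩ := hfr.exists
    exact ⟨_, key s' γ h0 hlt h1 h2 h3 0⟩
  obtain ⟨α, β, hαβ, hS, hsub, -, -⟩ := exists_Icc_of_isCompact hI' hSc hSne fun x hx => hx.1
  refine mem_periodicMomenta_of_frequently hI hV hαβ hsub hs0 (hfr.mono ?_)
  rintro s' ⟨γ, h0, hlt, h1, h2, h3⟩
  exact ⟨γ, h1, h2, h3, fun t => hS (key s' γ h0 hlt h1 h2 h3 t)⟩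

/-- If `T`-periodicity of trajectories persists under small changes of the momentum at the bottom
of a well, then the well is global and all its trajectories are `T`-periodic. -/
theorem isPeriodicWell_of_isOpen (hI : IsOpen I) (hI' : I.OrdConnected) (hV : ContDiffOn ℝ 2 V I)
    (hend : ∀ c ∈ frontier I, Tendsto V (𝓝[I] c) atTop) (hxI : x₀ ∈ I)
    (hT : 0 < T) (hx₀ : deriv V x₀ = 0) (hopen : IsOpen (periodicMomenta I V x₀ T))
    (hne : (periodicMomenta I V x₀ T).Nonempty) : IsPeriodicWell I V x₀ T := by
  have hA := periodicMomenta_eq_Ioi hI hI' hV hend hT hx₀ hopen hne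
  have horb : ∀ s, 0 < s → ∃ γ, IsTrajectory I V γ ∧ γ 0 = (x₀, s) ∧ Function.Periodic γ T :=
    fun s hs => (hA.symm ▸ hs : s ∈ periodicMomenta I V x₀ T).2
  have hturn : ∀ c ∈ I, c ≠ x₀ → ∃ s, 0 < s ∧ ∃ γ, IsTrajectory I V γ ∧ γ 0 = (x₀, s) ∧
      Function.Periodic γ T ∧ ∃ t, γ t = (c, 0) := by
    intro c hc hcx
    have hsub : uIcc x₀ c ⊆ I := hI'.uIcc_subset hxI hc
    obtain ⟨B, hB⟩ := isCompact_uIcc.bddAbove_image (hV.continuousOn.mono hsub)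
    have hB' : ∀ x ∈ uIcc x₀ c, V x ≤ B := fun x hx => hB (mem_image_of_mem V hx)
    -- This makes the energy exceed the bound `B` of the potential between `x₀` and `c`, so neither
    -- end of the orbit's range can lie between them and the range contains `c`.
    set s₁ := |B - V x₀| + 2
    have hs₁ : 0 < s₁ := by positivity
    have hE : B < s₁ ^ 2 / 2 + V x₀ := by
      have := le_abs_self (B - V x₀)
      have := abs_nonneg (B - V x₀)
      simp only [s₁]
      nlinarith
    obtain ⟨γ, hγ, hγ0, hper⟩ := horb s₁ hs₁
    obtain ⟨α, β, a, b, hαβ, hr, ha, hb⟩ := hγ.exists_range_fst_eq_Icc hT.ne' hper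
    have hx : x₀ ∈ Icc α β := hr ▸ ⟨0, by simp [hγ0]⟩
    have hα : α ∉ uIcc x₀ c := fun h => by
      have := potential_eq_of_turning hI hV hγ hγ0 ha
      linarith [hB' α h]
    have hβ : β ∉ uIcc x₀ c := fun h => by
      have := potential_eq_of_turning hI hV hγ hγ0 hb
      linarith [hB' β h]
    have hcr : c ∈ range fun t => (γ t).1 := by
      rw [hr]
      constructor
      · by_contra hlt
        exact hα (mem_uIcc.2 (Or.inr ⟨(not_le.1 hlt).le, hx.1⟩))
      · by_contra hlt
        exact hβ (mem_uIcc.2 (Or.inl ⟨hx.2, (not_le.1 hlt).le⟩))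
    obtain ⟨s, hs, -, h⟩ := exists_turning hI hV hT hx₀ hopen hs₁ hγ hγ0 hper hcr hcx
    exact ⟨s, hs, h⟩
  have hlt : ∀ c ∈ I, c ≠ x₀ → V x₀ < V c := by
    intro c hc hcx
    obtain ⟨s, hs, γ, hγ, hγ0, -, t, ht⟩ := hturn c hc hcx
    have := potential_eq_of_turning hI hV hγ hγ0 ht
    nlinarith
  have hrange : ∀ s γ, 0 < s → IsTrajectory I V γ → γ 0 = (x₀, s) → Function.Periodic γ T →
      ∀ x ∈ I, V x < s ^ 2 / 2 + V x₀ → x ∈ range fun t => (γ t).1 := by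
    intro s γ hs hγ hγ0 hper x hx hVx
    by_cases hxx : x = x₀
    · exact ⟨0, by simp [hγ0, hxx]⟩
    obtain ⟨s', hs', γ', hγ', hγ'0, -, t, ht⟩ := hturn x hx hxx
    have h1 := potential_eq_of_turning hI hV hγ' hγ'0 ht
    have h2 : s' < s := by nlinarith
    exact range_fst_subset_of_lt hI hV hT hγ hγ' hγ0 hγ'0 hper hs' h2 ⟨t, by simp [ht]⟩
  refine ⟨hxI, hx₀, hT, ?_, ?_, hlt, ?_⟩
  · rintro ⟨x, p⟩ hx hw
    simp only at hx
    by_cases hp : p = 0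
    · subst hp
      exact hturn x hx fun h => hw (by rw [h])
    have hE : V x₀ < p ^ 2 / 2 + V x := by
      have h1 : 0 < p ^ 2 := by positivity
      rcases eq_or_ne x x₀ with rfl | h
      · linarith
      · linarith [hlt x hx h]
    set s := √(2 * (p ^ 2 / 2 + V x - V x₀))
    have hs : 0 < s := Real.sqrt_pos.2 (by linarith)
    have hs2 : s ^ 2 = 2 * (p ^ 2 / 2 + V x - V x₀) := Real.sq_sqrt (by linarith)
    obtain ⟨γ, hγ, hγ0, hper⟩ := horb s hs
    refine ⟨s, hs, γ, hγ, hγ0, hper, ?_⟩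
    have hp2 : 0 < p ^ 2 := by positivity
    obtain ⟨t, ht⟩ := hrange s γ hs hγ hγ0 hper x hx (by linarith)
    simp only at ht
    have hen := hγ.hamiltonian1_eq hI hV t 0
    simp only [hamiltonian1, hγ0, ht] at hen
    -- At the right position and energy the momentum is `p` or `-p`; in the second case, reflection
    -- about a turning point gives the required point of the same trajectory.
    have hsq : ((γ t).2 - p) * ((γ t).2 + p) = 0 := by nlinarith
    rcases mul_eq_zero.1 hsq with h | h
    · exact ⟨t, Prod.ext ht (by simp only; linarith)⟩
    · obtain ⟨α, β, a, b, hαβ, hr, ha, hb⟩ := hγ.exists_range_fst_eq_Icc hT.ne' hper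
      refine ⟨2 * a - t, ?_⟩
      rw [hγ.apply_reflect hI hI' hV (by rw [ha])]
      exact Prod.ext ht (by simp only; linarith)
  · intro c hc hcx hd
    obtain ⟨s, hs, γ, hγ, hγ0, -, t, ht⟩ := hturn c hc hcx
    have := hγ.eq_const_of_equilibrium hI hI' hV (a := t) (by rw [ht]) (by rw [ht]; exact hd) 0
    rw [hγ0, ht, Prod.mk.injEq] at this
    exact hcx this.1.symm
  · intro E
    set s := |E - V x₀| + 2
    have hs : 0 < s := by positivity
    have hE : E < s ^ 2 / 2 + V x₀ := by
      have := le_abs_self (E - V x₀)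
      have := abs_nonneg (E - V x₀)
      simp only [s]
      nlinarith
    obtain ⟨γ, hγ, hγ0, hper⟩ := horb s hs
    obtain ⟨α, β, hαβ, hsub, hr⟩ := exists_Icc_range_fst hT hγ hper
    exact ⟨α, β, hαβ, hsub, fun x hx hVx => hr ▸ hrange s γ hs hγ hγ0 hper x hx (by linarith)⟩

end Well

/-! ### Periodic trajectories near a strict minimum, and least periods. -/

/-- By the mean value theorem on `[t, t + 1]` the derivative takes, at arbitrarily late times,
values equal to increments of `f`, which tend to zero. -/
theorem eq_zero_of_tendsto_of_tendsto_deriv {f f' : ℝ → ℝ} {c l : ℝ}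
    (hd : ∀ t, HasDerivAt f (f' t) t) (hf : Tendsto f atTop (𝓝 c)) (hf' : Tendsto f' atTop (𝓝 l)) :
    l = 0 := by
  have hmv : ∀ t : ℝ, ∃ ξ ∈ Ioo t (t + 1), f' ξ = f (t + 1) - f t := by
    intro t
    obtain ⟨ξ, hξ, h⟩ := exists_hasDerivAt_eq_slope f f' (by linarith : t < t + 1)
      (fun x _ => (hd x).continuousAt.continuousWithinAt) (fun x _ => hd x)
    exact ⟨ξ, hξ, by rw [h]; simp⟩
  choose ξ hξ hξ' using hmv
  have h1 : Tendsto ξ atTop atTop := tendsto_atTop_mono (fun t => (hξ t).1.le) tendsto_id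
  have h2 := hf'.comp h1
  have h3 : Tendsto (fun t => f (t + 1) - f t) atTop (𝓝 (c - c)) :=
    (hf.comp (tendsto_atTop_add_const_right _ 1 tendsto_id)).sub hf
  rw [sub_self] at h3
  exact tendsto_nhds_unique h2 (h3.congr fun t => (hξ' t).symm)

theorem exists_tendsto_of_deriv_ne_zero {f f' : ℝ → ℝ} (hd : ∀ t, HasDerivAt f (f' t) t)
    (hc : Continuous f') (hb : Bornology.IsBounded (range f)) (hne : ∀ t, 0 < t → f' t ≠ 0) :
    ∃ σ c : ℝ, (∀ t, 0 < t → f' t = σ * |f' t|) ∧ Tendsto f atTop (𝓝 c) := by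
  -- The derivative has constant sign only for positive times; precomposing with `max t 1` gives a
  -- function monotone on the whole line that is eventually equal to `f`.
  have hmax : ∀ᶠ t : ℝ in atTop, max t 1 = t :=
    (eventually_ge_atTop 1).mono fun t ht => max_eq_left ht
  have hdiff : Differentiable ℝ f := fun t => (hd t).differentiableAt
  have hsign : (∀ t, 0 < t → 0 < f' t) ∨ (∀ t, 0 < t → f' t < 0) := by
    by_contra hcon
    push Not at hcon
    obtain ⟨⟨a, ha, ha'⟩, b, hb, hb'⟩ := hcon
    obtain ⟨t, ht, h0⟩ := isPreconnected_Ioi.intermediate_value (mem_Ioi.2 ha) (mem_Ioi.2 hb)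
      hc.continuousOn ⟨ha', hb'⟩
    exact hne t ht h0
  rcases hsign with h | h
  · have hmono : Monotone fun t => f (max t 1) := by
      have h1 : MonotoneOn f (Ici 1) := monotoneOn_of_deriv_nonneg (convex_Ici 1)
        hdiff.continuous.continuousOn hdiff.differentiableOn fun t ht => by
          rw [interior_Ici, mem_Ioi] at ht
          rw [(hd t).deriv]
          exact (h t (by linarith)).le
      exact fun s t hst => h1 (le_max_right s 1) (le_max_right t 1) (max_le_max_right 1 hst)
    refine ⟨1, _, fun t ht => by rw [one_mul, abs_of_pos (h t ht)],
      (tendsto_atTop_ciSup hmono (hb.bddAbove.mono ?_)).congr' (hmax.mono fun t ht => by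
        simp only [ht])⟩
    rintro _ ⟨t, rfl⟩
    exact mem_range_self _
  · have hmono : Antitone fun t => f (max t 1) := by
      have h1 : AntitoneOn f (Ici 1) := antitoneOn_of_deriv_nonpos (convex_Ici 1)
        hdiff.continuous.continuousOn hdiff.differentiableOn fun t ht => by
          rw [interior_Ici, mem_Ioi] at ht
          rw [(hd t).deriv]
          exact (h t (by linarith)).le
      exact fun s t hst => h1 (le_max_right s 1) (le_max_right t 1) (max_le_max_right 1 hst)
    refine ⟨-1, _, fun t ht => by rw [abs_of_neg (h t ht)]; ring,
      (tendsto_atTop_ciInf hmono (hb.bddBelow.mono ?_)).congr' (hmax.mono fun t ht => by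
        simp only [ht])⟩
    rintro _ ⟨t, rfl⟩
    exact mem_range_self _

/-- A bounded trajectory at a regular energy has a turning point in the future. -/
theorem IsTrajectory.exists_turning_time {I : Set ℝ} {V : ℝ → ℝ} {γ : ℝ → ℝ × ℝ} {α β E : ℝ}
    (h : IsTrajectory I V γ) (hI : IsOpen I) (hV : ContDiffOn ℝ 2 V I) (hsub : Icc α β ⊆ I)
    (hmem : ∀ t, (γ t).1 ∈ Icc α β) (hE : hamiltonian1 V (γ 0) = E)
    (hreg : ∀ x ∈ Icc α β, V x = E → deriv V x ≠ 0) : ∃ a, 0 < a ∧ (γ a).2 = 0 := by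
  -- Without a turning point the position converges monotonically to some `c`. Energy makes the
  -- momentum converge too, necessarily to zero, so `V c = E`; then the force tends to `-deriv V c`,
  -- which must also be zero, against regularity.
  by_contra! hcon
  obtain ⟨σ, c, hσ, hc⟩ := exists_tendsto_of_deriv_ne_zero h.hasDerivAt_fst h.continuous_snd
    (Metric.isBounded_Icc α β |>.subset (by rintro _ ⟨t, rfl⟩; exact hmem t)) hcon
  have hcm : c ∈ Icc α β := isClosed_Icc.mem_of_tendsto hc (Eventually.of_forall hmem)
  have hVc : Tendsto (fun t => V (γ t).1) atTop (𝓝 (V c)) :=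
    (hV.continuousOn.continuousAt (hI.mem_nhds (hsub hcm))).tendsto.comp hc
  have hV'c : Tendsto (fun t => -deriv V (γ t).1) atTop (𝓝 (-deriv V c)) :=
    (((hV.continuousOn_deriv_of_isOpen hI one_le_two).continuousAt
      (hI.mem_nhds (hsub hcm))).tendsto.comp hc).neg
  have hP : Tendsto (fun t => (γ t).2) atTop (𝓝 (σ * √(2 * (E - V c)))) := by
    have h1 : Tendsto (fun t => σ * √(2 * (E - V (γ t).1))) atTop (𝓝 (σ * √(2 * (E - V c)))) :=
      ((Real.continuous_sqrt.tendsto _).comp ((tendsto_const_nhds.sub hVc).const_mul 2)).const_mul σ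
    refine h1.congr' ((eventually_gt_atTop 0).mono fun t ht => ?_)
    have h2 := h.hamiltonian1_eq hI hV t 0
    rw [hE, hamiltonian1] at h2
    rw [show 2 * (E - V (γ t).1) = (γ t).2 ^ 2 by linarith, Real.sqrt_sq_eq_abs, ← hσ t ht]
  have hl := eq_zero_of_tendsto_of_tendsto_deriv h.hasDerivAt_fst hc hP
  rw [hl] at hP
  have hVE : V c = E := by
    have h1 : Tendsto (fun t => hamiltonian1 V (γ t)) atTop (𝓝 (0 ^ 2 / 2 + V c)) :=
      ((hP.pow 2).div_const 2).add hVc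
    have h2 : Tendsto (fun t => hamiltonian1 V (γ t)) atTop (𝓝 E) :=
      tendsto_const_nhds.congr fun t => by rw [← hE]; exact h.hamiltonian1_eq hI hV 0 t
    simpa using tendsto_nhds_unique h1 h2
  have := eq_zero_of_tendsto_of_tendsto_deriv h.hasDerivAt_snd hP hV'c
  exact hreg c hcm hVE (by linarith)

/-- There are periodic trajectories around a strict local minimum. -/
theorem exists_mem_periodicMomenta {I : Set ℝ} {V : ℝ → ℝ} {x₀ : ℝ} (hI : IsOpen I)
    (hI' : I.OrdConnected) (hV : ContDiffOn ℝ 2 V I) (hx₀ : x₀ ∈ I) (hmin : IsStrictLocalMin V x₀) :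
    ∃ T, 0 < T ∧ (periodicMomenta I V x₀ T).Nonempty := by
  obtain ⟨r, hr, hrs⟩ : ∃ r, 0 < r ∧ ∀ x ∈ Icc (x₀ - r) (x₀ + r), x ∈ I ∧ (x ≠ x₀ → V x₀ < V x) := by
    have h1 : ∀ᶠ x in 𝓝 x₀, x ∈ I ∧ (x ≠ x₀ → V x₀ < V x) :=
      Eventually.and (hI.mem_nhds hx₀) (eventually_nhdsWithin_iff.1 hmin)
    obtain ⟨ε, hε, hb⟩ := Metric.nhds_basis_closedBall.eventually_iff.1 h1
    rw [Real.closedBall_eq_Icc] at hb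
    exact ⟨ε, hε, fun x hx => hb hx⟩
  set α := x₀ - r
  set β := x₀ + r
  have hαβ : α ≤ β := by simp only [α, β]; linarith
  have hsub : Icc α β ⊆ I := fun x hx => (hrs x hx).1
  have hVα : V x₀ < V α := (hrs α ⟨le_rfl, hαβ⟩).2 (by simp only [α]; linarith)
  have hVβ : V x₀ < V β := (hrs β ⟨hαβ, le_rfl⟩).2 (by simp only [β]; linarith)
  -- One-dimensional Sard: the image of the critical set is null and cannot contain an interval of
  -- energies. A regular energy is needed because nearby critical points are not excluded.
  obtain ⟨E, ⟨hE0, hE1⟩, hEreg⟩ : ∃ E ∈ Ioo (V x₀) (min (V α) (V β)),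
      E ∉ V '' {x | x ∈ I ∧ deriv V x = 0} := by
    by_contra! hcon
    have h0 : MeasureTheory.volume (V '' {x | x ∈ I ∧ deriv V x = 0}) = 0 := by
      refine MeasureTheory.addHaar_image_eq_zero_of_det_fderivWithin_eq_zero _
        (f' := fun _ => (0 : ℝ →L[ℝ] ℝ)) (fun x hx => ?_) (fun x _ => by simp [ContinuousLinearMap.det])
      have := ((hV.differentiableOn two_ne_zero).differentiableAt (hI.mem_nhds hx.1)).hasDerivAt
      rw [hx.2] at this
      exact (this.hasFDerivAt.congr_fderiv (by ext; simp)).hasFDerivWithinAt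
    have h1 := MeasureTheory.measure_mono_null hcon h0
    rw [Real.volume_Ioo, ENNReal.ofReal_eq_zero] at h1
    linarith [lt_min hVα hVβ]
  have hreg : ∀ x ∈ Icc α β, V x = E → deriv V x ≠ 0 := fun x hx hVx hd =>
    hEreg ⟨x, ⟨hsub hx, hd⟩, hVx⟩
  set s := √(2 * (E - V x₀))
  have hs : 0 < s := Real.sqrt_pos.2 (by linarith)
  have hs2 : s ^ 2 = 2 * (E - V x₀) := Real.sq_sqrt (by linarith)
  obtain ⟨F⟩ := exists_truncatedFlow hI hV hαβ hsub
  have hx₀m : x₀ ∈ Icc α β := ⟨by simp only [α]; linarith, by simp only [β]; linarith⟩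
  have hne : ∀ c ∈ Icc α β, E < V c → c ∉ range fun t => (F.flow t (x₀, s)).1 := by
    rintro c hc hcE ⟨t, ht⟩
    have := F.hamiltonian1_flow t (x₀, s)
    simp only at ht
    simp only [hamiltonian1, ht] at this
    rw [F.pot_eq hc, F.pot_eq hx₀m] at this
    nlinarith [sq_nonneg (F.flow t (x₀, s)).2]
  have hmem : ∀ t, (F.flow t (x₀, s)).1 ∈ Icc α β := by
    intro t
    have hconn := (isPreconnected_range (F.isTrajectory (x₀, s)).continuous_fst).ordConnected
    have h0 : x₀ ∈ range fun t => (F.flow t (x₀, s)).1 := ⟨0, by simp [F.flow_zero]⟩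
    constructor
    · by_contra hlt
      exact hne α ⟨le_rfl, hαβ⟩ (hE1.trans_le (min_le_left _ _))
        (hconn.out (mem_range_self t) h0 ⟨(not_le.1 hlt).le, hx₀m.1⟩)
    · by_contra hlt
      exact hne β ⟨hαβ, le_rfl⟩ (hE1.trans_le (min_le_right _ _))
        (hconn.out h0 (mem_range_self t) ⟨hx₀m.2, (not_le.1 hlt).le⟩)
  have htraj := F.isTrajectory_of_forall_mem hsub hmem
  have hen : hamiltonian1 V (F.flow 0 (x₀, s)) = E := by
    simp only [F.flow_zero, hamiltonian1]; linarith
  obtain ⟨a, ha, hPa⟩ := htraj.exists_turning_time hI hV hsub hmem hen hreg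
  -- The reversed trajectory yields a turning point at the negative time `-b`; with the one at `a >
  -- 0` this gives the positive period `2 * (a + b)`.
  obtain ⟨b, hb, hPb⟩ := (htraj.reverse 0).exists_turning_time hI hV hsub (fun t => hmem _)
    (E := E) (by simpa [hamiltonian1] using hen) hreg
  have hPb' : (F.flow (-b) (x₀, s)).2 = 0 := by simpa using hPb
  exact ⟨2 * (a - -b), by linarith, s, hs, _, htraj, F.flow_zero _,
    htraj.periodic_of_turning hI hI' hV hPb' hPa⟩

/-- A nonconstant periodic continuous curve has a least positive period. -/
theorem exists_hasPeriod {γ : ℝ → ℝ × ℝ} (hc : Continuous γ) {T : ℝ} (hT : 0 < T)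
    (hper : Function.Periodic γ T) (hne : ¬ ∃ c, ∀ t, γ t = c) : ∃ T', HasPeriod γ T' := by
  -- The periods form a closed subgroup of the line: it is all of the line, making the curve
  -- constant, or cyclic, with a least positive element.
  let S : AddSubgroup ℝ :=
    { carrier := {a | Function.Periodic γ a}
      zero_mem' := fun t => by simp
      add_mem' := fun ha hb => ha.add_period hb
      neg_mem' := fun ha => ha.neg }
  have hcl : IsClosed (S : Set ℝ) := by
    have : (S : Set ℝ) = ⋂ t, {a | γ (t + a) = γ t} := by
      ext a; simp [S, Function.Periodic]
    rw [this]
    exact isClosed_iInter fun t => isClosed_eq (hc.comp (continuous_const.add continuous_id))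
      continuous_const
  rcases S.dense_or_cyclic with hd | ⟨a, ha⟩
  · exfalso
    refine hne ⟨γ 0, fun t => ?_⟩
    have : t ∈ (S : Set ℝ) := by rw [← hcl.closure_eq]; exact hd t
    simpa using (this : Function.Periodic γ t) 0
  · have hTS : T ∈ S := hper
    have ha0 : a ≠ 0 := by
      rintro rfl
      rw [ha, AddSubgroup.mem_closure_singleton] at hTS
      obtain ⟨n, hn⟩ := hTS
      simp at hn
      exact hT.ne hn
    have haS : a ∈ S := by rw [ha]; exact AddSubgroup.subset_closure (mem_singleton a)
    refine ⟨|a|, ⟨abs_pos.2 ha0, ?_⟩, ?_⟩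
    · rcases abs_choice a with h | h <;> rw [h]
      · exact haS
      · exact S.neg_mem haS
    · rintro b ⟨hb0, hb⟩
      have hbS : b ∈ S := hb
      rw [ha, AddSubgroup.mem_closure_singleton] at hbS
      obtain ⟨n, rfl⟩ := hbS
      have hn : n ≠ 0 := by rintro rfl; simp at hb0
      rw [← abs_of_pos hb0, zsmul_eq_mul, abs_mul]
      have : (1 : ℝ) ≤ |(n : ℝ)| := by exact_mod_cast Int.one_le_abs hn
      exact le_mul_of_one_le_left (abs_nonneg a) this

/-! ### Rigidity of rational period ratios. -/

/-- The continuous image of an interval is an interval, and a nondegenerate one contains an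
irrational number. -/
theorem eventually_eq_of_eventually_rational {f : ℝ → ℝ} {s : ℝ}
    (hc : ∀ᶠ t in 𝓝 s, ContinuousAt f t) (hq : ∀ᶠ t in 𝓝 s, ∃ q : ℚ, f t = q) :
    ∀ᶠ t in 𝓝 s, f t = f s := by
  obtain ⟨ε, hε, hb⟩ := Metric.nhds_basis_ball.eventually_iff.1 (hc.and hq)
  filter_upwards [Metric.ball_mem_nhds s hε] with t ht
  have hord : (f '' Metric.ball s ε).OrdConnected :=
    ((convex_ball s ε).isPreconnected.image f
      fun x hx => (hb hx).1.continuousWithinAt).ordConnected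
  have key : ∀ a ∈ f '' Metric.ball s ε, ∀ b ∈ f '' Metric.ball s ε, ¬ a < b := by
    intro a ha b hb' hab
    obtain ⟨x, hx, hax, hxb⟩ := exists_irrational_btwn hab
    obtain ⟨y, hy, rfl⟩ := hord.out ha hb' ⟨hax.le, hxb.le⟩
    obtain ⟨q, hq⟩ := (hb hy).2
    exact hx ⟨q, hq.symm⟩
  have h1 := mem_image_of_mem f ht
  have h2 := mem_image_of_mem f (Metric.mem_ball_self (x := s) hε)
  exact le_antisymm (not_lt.1 (key _ h2 _ h1)) (not_lt.1 (key _ h1 _ h2))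

/-- A `C¹` function whose ratios to another function are rational on a dense open set of
pairs of arguments is locally constant. -/
theorem eventually_eq_of_rational_ratio {τ σ : ℝ → ℝ} {s₀ r₀ : ℝ} (hτ : ContDiffAt ℝ 1 τ s₀)
    (hσ : ∀ᶠ r in 𝓝 r₀, σ r ≠ 0) {D : Set (ℝ × ℝ)} (hD : IsOpen D)
    (hdense : ∀ᶠ p in 𝓝 (s₀, r₀), p ∈ closure D)
    (hrat : ∀ᶠ p in 𝓝 (s₀, r₀), p ∈ D → ∃ q : ℚ, τ p.1 / σ p.2 = q) :
    ∀ᶠ s in 𝓝 s₀, τ s = τ s₀ := by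
  have hall : ∀ᶠ p : ℝ × ℝ in 𝓝 (s₀, r₀), ContDiffAt ℝ 1 τ p.1 ∧ σ p.2 ≠ 0 ∧ p ∈ closure D ∧
      (p ∈ D → ∃ q : ℚ, τ p.1 / σ p.2 = q) := by
    have h1 := (continuousAt_fst (p := (s₀, r₀))).eventually (hτ.eventually (by simp))
    have h2 := (continuousAt_snd (p := (s₀, r₀))).eventually hσ
    filter_upwards [h1, h2, hdense, hrat] with p h1 h2 h3 h4 using ⟨h1, h2, h3, h4⟩
  obtain ⟨ε, hε, hb⟩ := Metric.nhds_basis_ball.eventually_iff.1 hall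
  have hb' : ∀ s ∈ Metric.ball s₀ ε, ∀ r ∈ Metric.ball r₀ ε, ContDiffAt ℝ 1 τ s ∧ σ r ≠ 0 ∧
      (s, r) ∈ closure D ∧ ((s, r) ∈ D → ∃ q : ℚ, τ s / σ r = q) := fun s hs r hr =>
    hb (x := (s, r)) (by rw [← ball_prod_same]; exact ⟨hs, hr⟩)
  have hr₀ : r₀ ∈ Metric.ball r₀ ε := Metric.mem_ball_self hε
  -- A nonzero derivative would persist at some nearby point of `D`. Near it, with the second
  -- argument frozen, the ratio is continuous and rational, so `τ` is locally constant and its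
  -- derivative is zero.
  have hderiv : ∀ s ∈ Metric.ball s₀ ε, deriv τ s = 0 := by
    intro s hs
    by_contra hne
    have hdc : ContinuousAt (deriv τ) s := by
      have hon : ContDiffOn ℝ 1 τ (Metric.ball s₀ ε) := fun s hs =>
        (hb' s hs r₀ hr₀).1.contDiffWithinAt
      exact (hon.continuousOn_deriv_of_isOpen Metric.isOpen_ball le_rfl).continuousAt
        (Metric.isOpen_ball.mem_nhds hs)
    have h1 : ∀ᶠ p : ℝ × ℝ in 𝓝 (s, r₀), deriv τ p.1 ≠ 0 ∧ p.1 ∈ Metric.ball s₀ ε ∧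
        p.2 ∈ Metric.ball r₀ ε :=
      ((continuousAt_fst (p := (s, r₀))).eventually (hdc.eventually_ne hne)).and
        (((continuousAt_fst (p := (s, r₀))).eventually (Metric.isOpen_ball.mem_nhds hs)).and
          ((continuousAt_snd (p := (s, r₀))).eventually (Metric.isOpen_ball.mem_nhds hr₀)))
    obtain ⟨⟨s', r'⟩, hD', hne', hs', hr'⟩ :=
      ((mem_closure_iff_frequently.1 (hb' s hs r₀ hr₀).2.2.1).and_eventually h1).exists
    simp only at hne' hs' hr'
    have h2 : ∀ᶠ t in 𝓝 s', t ∈ Metric.ball s₀ ε ∧ (t, r') ∈ D :=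
      Eventually.and (Metric.isOpen_ball.mem_nhds hs')
        ((Continuous.prodMk_left r').continuousAt.eventually (hD.mem_nhds hD'))
    have hσr := (hb' s' hs' r' hr').2.1
    have h3 := eventually_eq_of_eventually_rational (f := fun t => τ t / σ r') (s := s')
      (h2.mono fun t ht => (hb' t ht.1 r' hr').1.continuousAt.div_const _)
      (h2.mono fun t ht => (hb' t ht.1 r' hr').2.2.2 ht.2)
    have h4 : τ =ᶠ[𝓝 s'] fun _ => τ s' := h3.mono fun t ht => by
      simpa [hσr] using (div_left_inj' hσr).1 ht
    exact hne' (by rw [h4.deriv_eq]; simp)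
  filter_upwards [Metric.ball_mem_nhds s₀ hε] with s hs
  exact (convex_ball s₀ ε).is_const_of_fderivWithin_eq_zero (𝕜 := ℝ)
    (fun t ht => ((hb' t ht r₀ hr₀).1.differentiableAt one_ne_zero).differentiableWithinAt)
    (fun t ht => by
      rw [fderivWithin_of_isOpen Metric.isOpen_ball ht]
      ext
      simpa using hderiv t ht) hs (Metric.mem_ball_self hε)

/-! ### Integrals of motion on products of trajectories. -/

section Brackets

variable {I J : Set ℝ} {Va Vb : ℝ → ℝ} {Q : Phase2 → ℝ}

theorem isOpen_phaseSpace (hI : IsOpen I) (hJ : IsOpen J) : IsOpen (phaseSpace I J) :=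
  (hI.prod isOpen_univ).prod (hJ.prod isOpen_univ)

theorem mem_phaseSpace {z : Phase2} : z ∈ phaseSpace I J ↔ z.1.1 ∈ I ∧ z.2.1 ∈ J := by
  simp [phaseSpace]

theorem hasFDerivAt_hamiltonian1 {V : ℝ → ℝ} {w : ℝ × ℝ} (h : DifferentiableAt ℝ V w.1) :
    HasFDerivAt (hamiltonian1 V) (w.2 • ContinuousLinearMap.snd ℝ ℝ ℝ
      + deriv V w.1 • ContinuousLinearMap.fst ℝ ℝ ℝ) w := by
  have h1 := (((hasFDerivAt_snd (𝕜 := ℝ) (p := w)).pow 2).mul_const (2⁻¹ : ℝ)).add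
    (h.hasDerivAt.hasFDerivAt.comp w (hasFDerivAt_fst (𝕜 := ℝ) (p := w)))
  refine (h1.congr_fderiv ?_).congr_of_eventuallyEq (Eventually.of_forall fun v => ?_)
  · ext <;> simp
  · simp [hamiltonian1, div_eq_mul_inv]

theorem fderiv_hamiltonian1_fst {z v : Phase2} (h : DifferentiableAt ℝ Va z.1.1) :
    fderiv ℝ (fun z : Phase2 => hamiltonian1 Va z.1) z v
      = z.1.2 * v.1.2 + deriv Va z.1.1 * v.1.1 := by
  have := (hasFDerivAt_hamiltonian1 h).comp z (hasFDerivAt_fst (𝕜 := ℝ) (p := z))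
  have h2 := this.fderiv
  simp only [Function.comp_def] at h2
  rw [h2]
  simp

theorem fderiv_hamiltonian1_snd {z v : Phase2} (h : DifferentiableAt ℝ Vb z.2.1) :
    fderiv ℝ (fun z : Phase2 => hamiltonian1 Vb z.2) z v
      = z.2.2 * v.2.2 + deriv Vb z.2.1 * v.2.1 := by
  have := (hasFDerivAt_hamiltonian1 h).comp z (hasFDerivAt_snd (𝕜 := ℝ) (p := z))
  have h2 := this.fderiv
  simp only [Function.comp_def] at h2
  rw [h2]
  simp

theorem fderiv_separableHamiltonian {z v : Phase2} (ha : DifferentiableAt ℝ Va z.1.1)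
    (hb : DifferentiableAt ℝ Vb z.2.1) :
    fderiv ℝ (separableHamiltonian Va Vb) z v
      = (z.1.2 * v.1.2 + deriv Va z.1.1 * v.1.1) + (z.2.2 * v.2.2 + deriv Vb z.2.1 * v.2.1) := by
  have heq : separableHamiltonian Va Vb
      = (fun z : Phase2 => hamiltonian1 Va z.1) + fun z : Phase2 => hamiltonian1 Vb z.2 := by
    funext z
    simp only [separableHamiltonian, hamiltonian1, Pi.add_apply]
    ring
  have h1 : DifferentiableAt ℝ (fun z : Phase2 => hamiltonian1 Va z.1) z :=
    ((hasFDerivAt_hamiltonian1 ha).comp z (hasFDerivAt_fst (𝕜 := ℝ) (p := z))).differentiableAt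
  have h2 : DifferentiableAt ℝ (fun z : Phase2 => hamiltonian1 Vb z.2) z :=
    ((hasFDerivAt_hamiltonian1 hb).comp z (hasFDerivAt_snd (𝕜 := ℝ) (p := z))).differentiableAt
  rw [heq, fderiv_add h1 h2, add_apply,
    fderiv_hamiltonian1_fst ha, fderiv_hamiltonian1_snd hb]

/-- The Hamiltonian vector field of `p² / 2 + V(x)`. -/
noncomputable def hamiltonianField (V : ℝ → ℝ) (w : ℝ × ℝ) : ℝ × ℝ := (w.2, -deriv V w.1)

/-- The bracket with the Hamiltonian is the derivative along its vector field. -/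
theorem poissonBracket_separableHamiltonian {z : Phase2} (ha : DifferentiableAt ℝ Va z.1.1)
    (hb : DifferentiableAt ℝ Vb z.2.1) :
    poissonBracket Q (separableHamiltonian Va Vb) z
      = fderiv ℝ Q z (hamiltonianField Va z.1, 0) + fderiv ℝ Q z (0, hamiltonianField Vb z.2) := by
  have h1 : ((hamiltonianField Va z.1, 0) : Phase2)
      = z.1.2 • ((1, 0), (0, 0)) + (-deriv Va z.1.1) • ((0, 1), (0, 0)) := by
    simp [hamiltonianField, Prod.ext_iff]
  have h2 : ((0, hamiltonianField Vb z.2) : Phase2)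
      = z.2.2 • ((0, 0), (1, 0)) + (-deriv Vb z.2.1) • ((0, 0), (0, 1)) := by
    simp [hamiltonianField, Prod.ext_iff]
  rw [h1, h2]
  simp only [poissonBracket, fderiv_separableHamiltonian ha hb, map_add, map_smul, smul_eq_mul]
  ring

/-- At a point where both vector fields are nonzero, an integral of motion is independent of the two
energies if and only if it varies along the first vector field. -/
theorem linearIndependent_differentials_iff {z : Phase2} (ha : DifferentiableAt ℝ Va z.1.1)
    (hb : DifferentiableAt ℝ Vb z.2.1) (hXa : hamiltonianField Va z.1 ≠ 0)
    (hXb : hamiltonianField Vb z.2 ≠ 0)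
    (hQ : poissonBracket Q (separableHamiltonian Va Vb) z = 0) :
    LinearIndependent ℝ (fun i => fderiv ℝ ((![fun z => hamiltonian1 Va z.1,
      fun z => hamiltonian1 Vb z.2, Q] : Fin 3 → Phase2 → ℝ) i) z) ↔
      fderiv ℝ Q z (hamiltonianField Va z.1, 0) ≠ 0 := by
  rw [poissonBracket_separableHamiltonian ha hb] at hQ
  have hna : 0 < z.1.2 ^ 2 + deriv Va z.1.1 ^ 2 := by
    by_contra hcon
    refine hXa (Prod.ext ?_ ?_) <;> simp only [hamiltonianField, Prod.fst_zero, Prod.snd_zero] <;>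
      nlinarith [sq_nonneg z.1.2, sq_nonneg (deriv Va z.1.1)]
  have hnb : 0 < z.2.2 ^ 2 + deriv Vb z.2.1 ^ 2 := by
    by_contra hcon
    refine hXb (Prod.ext ?_ ?_) <;> simp only [hamiltonianField, Prod.fst_zero, Prod.snd_zero] <;>
      nlinarith [sq_nonneg z.2.2, sq_nonneg (deriv Vb z.2.1)]
  have hdec : ∀ v : Phase2, v = v.1.1 • ((1, 0), (0, 0)) + v.1.2 • ((0, 1), (0, 0))
      + v.2.1 • ((0, 0), (1, 0)) + v.2.2 • ((0, 0), (0, 1)) := fun v => by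
    simp [Prod.ext_iff]
  have hLdec : ∀ v : Phase2, fderiv ℝ Q z v = v.1.1 * fderiv ℝ Q z ((1, 0), (0, 0))
      + v.1.2 * fderiv ℝ Q z ((0, 1), (0, 0)) + v.2.1 * fderiv ℝ Q z ((0, 0), (1, 0))
      + v.2.2 * fderiv ℝ Q z ((0, 0), (0, 1)) := fun v => by
    conv_lhs => rw [hdec v]
    simp only [map_add, map_smul, smul_eq_mul]
  rw [Fintype.linearIndependent_iff]
  simp only [Fin.sum_univ_three]
  constructor
  · intro h hzero
    rw [hzero, zero_add] at hQ
    rw [hLdec] at hzero hQ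
    simp only [hamiltonianField, Prod.fst_zero, Prod.snd_zero] at hzero hQ
    set l₁ := fderiv ℝ Q z ((1, 0), (0, 0))
    set l₂ := fderiv ℝ Q z ((0, 1), (0, 0))
    set l₃ := fderiv ℝ Q z ((0, 0), (1, 0))
    set l₄ := fderiv ℝ Q z ((0, 0), (0, 1))
    -- In each plane a covector that kills the nonzero Hamiltonian field is a multiple of the energy
    -- differential; `A` and `B` are these multipliers, found by orthogonal projection.
    set A := (l₁ * deriv Va z.1.1 + l₂ * z.1.2) / (z.1.2 ^ 2 + deriv Va z.1.1 ^ 2) with hA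
    set B := (l₃ * deriv Vb z.2.1 + l₄ * z.2.2) / (z.2.2 ^ 2 + deriv Vb z.2.1 ^ 2) with hB
    rw [eq_div_iff hna.ne'] at hA
    rw [eq_div_iff hnb.ne'] at hB
    have h1 : l₁ = A * deriv Va z.1.1 := mul_right_cancel₀ hna.ne' (by
      linear_combination z.1.2 * hzero - deriv Va z.1.1 * hA)
    have h2 : l₂ = A * z.1.2 := mul_right_cancel₀ hna.ne' (by
      linear_combination -deriv Va z.1.1 * hzero - z.1.2 * hA)
    have h3 : l₃ = B * deriv Vb z.2.1 := mul_right_cancel₀ hnb.ne' (by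
      linear_combination z.2.2 * hQ - deriv Vb z.2.1 * hB)
    have h4 : l₄ = B * z.2.2 := mul_right_cancel₀ hnb.ne' (by
      linear_combination -deriv Vb z.2.1 * hQ - z.2.2 * hB)
    have := h ![-A, -B, 1] (ContinuousLinearMap.ext fun v => by
      simp [fderiv_hamiltonian1_fst ha, fderiv_hamiltonian1_snd hb, hLdec v]
      linear_combination v.1.1 * h1 + v.1.2 * h2 + v.2.1 * h3 + v.2.2 * h4) 2
    simp at this
  · intro hne g hg
    have happ : ∀ v : Phase2, g 0 * (z.1.2 * v.1.2 + deriv Va z.1.1 * v.1.1)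
        + g 1 * (z.2.2 * v.2.2 + deriv Vb z.2.1 * v.2.1) + g 2 * fderiv ℝ Q z v = 0 := fun v => by
      have := congrArg (fun L : Phase2 →L[ℝ] ℝ => L v) hg
      simpa [fderiv_hamiltonian1_fst ha, fderiv_hamiltonian1_snd hb] using this
    -- Evaluation on the first Hamiltonian field annihilates both energy differentials and isolates
    -- `Q`; the gradients of the energies then isolate the other coefficients.
    have hg2 : g 2 = 0 := by
      have := happ (hamiltonianField Va z.1, 0)
      simp only [hamiltonianField, Prod.fst_zero, Prod.snd_zero] at this hne
      refine (mul_eq_zero.1 ?_).resolve_right hne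
      linear_combination this
    have hg0 : g 0 = 0 := by
      have := happ ((deriv Va z.1.1, z.1.2), (0, 0))
      rw [hg2] at this
      refine (mul_eq_zero.1 ?_).resolve_right hna.ne'
      linear_combination this
    have hg1 : g 1 = 0 := by
      have := happ ((0, 0), (deriv Vb z.2.1, z.2.2))
      rw [hg2] at this
      refine (mul_eq_zero.1 ?_).resolve_right hnb.ne'
      linear_combination this
    intro i
    fin_cases i
    · exact hg0
    · exact hg1
    · exact hg2

/-- Integrals of motion are constant along pairs of trajectories. -/
theorem IsIntegralOfMotion.apply_trajectory (hI : IsOpen I) (hJ : IsOpen J)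
    (hVa : ContDiffOn ℝ 2 Va I) (hVb : ContDiffOn ℝ 2 Vb J)
    (hQ : IsIntegralOfMotion (phaseSpace I J) (separableHamiltonian Va Vb) Q)
    {γ δ : ℝ → ℝ × ℝ} (hγ : IsTrajectory I Va γ) (hδ : IsTrajectory J Vb δ) (a b h : ℝ) :
    Q (γ (a + h), δ (b + h)) = Q (γ a, δ b) := by
  have hd : ∀ t, HasDerivAt (fun t => Q (γ (a + t), δ (b + t))) 0 t := by
    intro t
    have hz : (γ (a + t), δ (b + t)) ∈ phaseSpace I J := mem_phaseSpace.2 ⟨hγ.mem _, hδ.mem _⟩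
    have h1 := ((hQ.1.differentiableOn one_ne_zero).differentiableAt
      ((isOpen_phaseSpace hI hJ).mem_nhds hz)).hasFDerivAt
    have h2 := ((hγ (a + t)).2.comp_const_add a t).prodMk ((hδ (b + t)).2.comp_const_add b t)
    refine (h1.comp_hasDerivAt t h2).congr_deriv ?_
    have h3 := hQ.2 _ hz
    rw [poissonBracket_separableHamiltonian
      ((hVa.differentiableOn two_ne_zero).differentiableAt (hI.mem_nhds (hγ.mem _)))
      ((hVb.differentiableOn two_ne_zero).differentiableAt (hJ.mem_nhds (hδ.mem _))),
      ← map_add, Prod.mk_add_mk, add_zero, zero_add] at h3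
    exact h3
  have := is_const_of_deriv_eq_zero (fun t => (hd t).differentiableAt) (fun t => (hd t).deriv) h 0
  simpa using this

/-- If an integral of motion varies along the first factor of a product of two periodic
trajectories, then their periods are commensurable. -/
theorem IsIntegralOfMotion.exists_rat_eq_div (hI : IsOpen I) (hJ : IsOpen J)
    (hVa : ContDiffOn ℝ 2 Va I) (hVb : ContDiffOn ℝ 2 Vb J)
    (hQ : IsIntegralOfMotion (phaseSpace I J) (separableHamiltonian Va Vb) Q)
    {γ δ : ℝ → ℝ × ℝ} (hγ : IsTrajectory I Va γ) (hδ : IsTrajectory J Vb δ) {τ σ : ℝ}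
    (hτ : Function.Periodic γ τ) (hσ : Function.Periodic δ σ) {t u : ℝ}
    (hne : fderiv ℝ Q (γ t, δ u) (hamiltonianField Va (γ t), 0) ≠ 0) :
    ∃ q : ℚ, τ / σ = q := by
  by_contra hirr
  have hirr' : Irrational (τ / σ) := fun ⟨q, hq⟩ => hirr ⟨q, hq.symm⟩
  let k : ℝ → ℝ := fun v => Q (γ (t + v), δ u)
  have hmem : ∀ v, (γ (t + v), δ u) ∈ phaseSpace I J := fun v =>
    mem_phaseSpace.2 ⟨hγ.mem _, hδ.mem _⟩
  have hkc : Continuous k := hQ.1.continuousOn.comp_continuous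
    ((hγ.continuous.comp (continuous_const.add continuous_id)).prodMk continuous_const) hmem
  let S : AddSubgroup ℝ :=
    { carrier := {a | Function.Periodic k a}
      zero_mem' := fun t => by simp
      add_mem' := fun ha hb => ha.add_period hb
      neg_mem' := fun ha => ha.neg }
  have hτS : τ ∈ S := fun v => by simp only [k, ← add_assoc, hτ _]
  -- Advancing both trajectories by `σ` preserves `Q` and returns `δ` to its starting point, so
  -- advancing `γ` alone by `σ` also preserves it.
  have hσS : σ ∈ S := fun v => by
    have := hQ.apply_trajectory hI hJ hVa hVb hγ hδ (t + v) u σ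
    rw [hσ u] at this
    simpa only [k, ← add_assoc] using this
  have hcl : IsClosed (S : Set ℝ) := by
    have : (S : Set ℝ) = ⋂ v, {a | k (v + a) = k v} := by
      ext a; simp [S, Function.Periodic]
    rw [this]
    exact isClosed_iInter fun v => isClosed_eq (hkc.comp (continuous_const.add continuous_id))
      continuous_const
  have hdense : Dense (S : Set ℝ) :=
    (dense_addSubgroupClosure_pair_iff.2 hirr').mono
      ((AddSubgroup.closure_le S).2 (by rintro x (rfl | rfl) <;> assumption))
  have hconst : k = fun _ => k 0 := funext fun v => by
    have : v ∈ (S : Set ℝ) := by rw [← hcl.closure_eq]; exact hdense v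
    simpa using (this : Function.Periodic k v) 0
  have hz := hmem 0
  rw [add_zero] at hz
  have h1 := ((hQ.1.differentiableOn one_ne_zero).differentiableAt
    ((isOpen_phaseSpace hI hJ).mem_nhds hz)).hasFDerivAt
  have h2 := ((hγ (t + 0)).2.comp_const_add t 0).prodMk (hasDerivAt_const (0 : ℝ) (δ u))
  have h3 : HasDerivAt k (fderiv ℝ Q (γ t, δ u) (hamiltonianField Va (γ t), 0)) 0 := by
    have h4 : HasFDerivAt Q (fderiv ℝ Q (γ t, δ u)) (γ (t + 0), δ u) := by rwa [add_zero]
    have := h4.comp_hasDerivAt (0 : ℝ) h2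
    simp only [add_zero] at this
    exact this
  rw [hconst] at h3
  exact hne (h3.unique (hasDerivAt_const _ _))

end Brackets

/-! ### Local constancy of the periods under superintegrability. -/

section Forward

variable {I J : Set ℝ} {Va Vb : ℝ → ℝ} {Q : Phase2 → ℝ}

theorem isOpen_setOf_fderiv_field_ne_zero (hI : IsOpen I) (hJ : IsOpen J)
    (hVa : ContDiffOn ℝ 2 Va I) (hQ : ContDiffOn ℝ 1 Q (phaseSpace I J)) :
    IsOpen {z | z ∈ phaseSpace I J ∧ fderiv ℝ Q z (hamiltonianField Va z.1, 0) ≠ 0} := by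
  have hM := isOpen_phaseSpace hI hJ
  have h1 : ContinuousOn (fun z : Phase2 => deriv Va z.1.1) (phaseSpace I J) :=
    (hVa.continuousOn_deriv_of_isOpen hI one_le_two).comp (by fun_prop) fun z hz =>
      (mem_phaseSpace.1 hz).1
  have h2 : ContinuousOn (fun z : Phase2 => ((hamiltonianField Va z.1, 0) : Phase2))
      (phaseSpace I J) := by
    unfold hamiltonianField
    exact ContinuousOn.prodMk (ContinuousOn.prodMk (by fun_prop) h1.neg) continuousOn_const
  have h3 : ContinuousOn (fun z : Phase2 => fderiv ℝ Q z (hamiltonianField Va z.1, 0))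
      (phaseSpace I J) := (hQ.continuousOn_fderiv_of_isOpen hM le_rfl).clm_apply h2
  exact h3.isOpen_inter_preimage hM isOpen_ne

/-- For a maximally superintegrable Hamiltonian the periods of nearby periodic trajectories are
the same, and those of the two factors are commensurable. -/
theorem eventually_periodic_of_superintegrable (hI : IsOpen I) (hI' : I.OrdConnected)
    (hJ : IsOpen J) (hJ' : J.OrdConnected) (hVa : ContDiffOn ℝ 2 Va I) (hVb : ContDiffOn ℝ 2 Vb J)
    (hQ : IsIntegralOfMotion (phaseSpace I J) (separableHamiltonian Va Vb) Q)
    (hind : FunctionallyIndependentOn (phaseSpace I J)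
      ![fun z => hamiltonian1 Va z.1, fun z => hamiltonian1 Vb z.2, Q])
    {x₀ y₀ T S s₀ r₀ : ℝ} (hT : 0 < T) (hS : 0 < S) (hs₀ : s₀ ≠ 0) (hr₀ : r₀ ≠ 0)
    {γ δ : ℝ → ℝ × ℝ} (hγ : IsTrajectory I Va γ) (hγ0 : γ 0 = (x₀, s₀))
    (hγT : Function.Periodic γ T) (hδ : IsTrajectory J Vb δ) (hδ0 : δ 0 = (y₀, r₀))
    (hδS : Function.Periodic δ S) :
    (∀ᶠ s in 𝓝 s₀, ∃ γ', IsTrajectory I Va γ' ∧ γ' 0 = (x₀, s) ∧ Function.Periodic γ' T) ∧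
    (∀ᶠ r in 𝓝 r₀, ∃ δ', IsTrajectory J Vb δ' ∧ δ' 0 = (y₀, r) ∧ Function.Periodic δ' S) ∧
    ∃ q : ℚ, T / S = q := by
  have hda : ∀ x ∈ I, DifferentiableAt ℝ Va x := fun x hx =>
    (hVa.differentiableOn two_ne_zero).differentiableAt (hI.mem_nhds hx)
  have hdb : ∀ x ∈ J, DifferentiableAt ℝ Vb x := fun x hx =>
    (hVb.differentiableOn two_ne_zero).differentiableAt (hJ.mem_nhds hx)
  have hx₀ : x₀ ∈ I := by have := hγ.mem 0; rwa [hγ0] at this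
  have hy₀ : y₀ ∈ J := by have := hδ.mem 0; rwa [hδ0] at this
  obtain ⟨Φ, τ, hΦc, hΦn, hτ, hτT, hΦ⟩ := hγ.exists_period_family hI hI' hVa hT hγT hγ0 hs₀
  obtain ⟨Ψ, σ, hΨc, hΨn, hσ, hσS, hΨ⟩ := hδ.exists_period_family hJ hJ' hVb hS hδS hδ0 hr₀
  set U := {z | z ∈ phaseSpace I J ∧ fderiv ℝ Q z (hamiltonianField Va z.1, 0) ≠ 0}
  have hU : IsOpen U := isOpen_setOf_fderiv_field_ne_zero hI hJ hVa hQ.1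
  -- Pairs of momenta whose product of orbits meets `U` somewhere: the periods, unlike the
  -- independence of differentials, do not depend on the point chosen on the torus.
  set D : Set (ℝ × ℝ) := {p | ∃ t u, (Φ t (x₀, p.1), Ψ u (y₀, p.2)) ∈ U}
  have hD : IsOpen D := by
    have : D = ⋃ t, ⋃ u, (fun p : ℝ × ℝ => (Φ t (x₀, p.1), Ψ u (y₀, p.2))) ⁻¹' U := by
      ext p; simp [D]
    rw [this]
    refine isOpen_iUnion fun t => isOpen_iUnion fun u => hU.preimage ?_
    exact (hΦc.comp (continuous_const.prodMk (continuous_const.prodMk continuous_fst))).prodMk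
      (hΨc.comp (continuous_const.prodMk (continuous_const.prodMk continuous_snd)))
  have hnhds : ∀ᶠ p : ℝ × ℝ in 𝓝 (s₀, r₀), p.1 ≠ 0 ∧ p.2 ≠ 0 :=
    (continuousAt_fst.eventually_ne hs₀).and (continuousAt_snd.eventually_ne hr₀)
  have hdense : ∀ᶠ p in 𝓝 (s₀, r₀), p ∈ closure D := by
    filter_upwards [hnhds] with ⟨s, r⟩ ⟨hs, hr⟩
    simp only at hs hr
    rw [mem_closure_iff_nhds]
    intro O hO
    obtain ⟨O₁, hO₁, O₂, hO₂, hO'⟩ := mem_nhds_prod_iff.1 hO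
    -- By the flow box, every point near `(x, s)` lies on an orbit with a momentum from `O`. Thus
    -- density of independent points passes to density of `D`; nonzero momentum ensures that the
    -- fields do not vanish.
    have hW : ∀ {Φ : ℝ → ℝ × ℝ → ℝ × ℝ} {x s : ℝ} {O : Set ℝ}, s ≠ 0 → O ∈ 𝓝 s →
        map (fun q : ℝ × ℝ => Φ q.1 (x, q.2)) (𝓝 (0, s)) = 𝓝 (x, s) →
        {w : ℝ × ℝ | w.2 ≠ 0 ∧ ∃ t, ∃ s' ∈ O, Φ t (x, s') = w} ∈ 𝓝 (x, s) := by
      intro Φ x s O hs hO hmap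
      refine inter_mem ((continuousAt_snd (p := (x, s))).eventually_ne hs) ?_
      have h1 : {q : ℝ × ℝ | q.2 ∈ O} ∈ 𝓝 ((0 : ℝ), s) := continuousAt_snd.preimage_mem_nhds hO
      have h2 := image_mem_map (m := fun q : ℝ × ℝ => Φ q.1 (x, q.2)) h1
      rw [hmap] at h2
      refine mem_of_superset h2 ?_
      rintro _ ⟨q, hq, rfl⟩
      exact ⟨q.1, q.2, hq, rfl⟩
    have hz : ((x₀, s), (y₀, r)) ∈ phaseSpace I J := mem_phaseSpace.2 ⟨hx₀, hy₀⟩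
    obtain ⟨z, ⟨⟨hz1, t, s', hs', hts⟩, ⟨hz2, u, r', hr', hur⟩⟩, hzM, hzLI⟩ :=
      mem_closure_iff_nhds.1 (hind hz) _ (prod_mem_nhds (hW hs hO₁ (hΦn s hs)) (hW hr hO₂ (hΨn r hr)))
    have hzI := mem_phaseSpace.1 hzM
    have := (linearIndependent_differentials_iff (hda _ hzI.1) (hdb _ hzI.2)
      (fun h => hz1 (congrArg Prod.fst h)) (fun h => hz2 (congrArg Prod.fst h))
      (hQ.2 z hzM)).1 hzLI
    exact ⟨(s', r'), hO' ⟨hs', hr'⟩, t, u, by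
      simp only [hts, hur]
      exact ⟨hzM, this⟩⟩
  have hrat : ∀ᶠ p in 𝓝 (s₀, r₀), p ∈ D → ∃ q : ℚ, τ p.1 / σ p.2 = q := by
    filter_upwards [(continuousAt_fst (p := (s₀, r₀))).eventually hΦ,
      (continuousAt_snd (p := (s₀, r₀))).eventually hΨ] with p h1 h2
    rintro ⟨t, u, hp⟩
    exact hQ.exists_rat_eq_div hI hJ hVa hVb h1.2.2.1 h2.2.2.1 h1.2.2.2 h2.2.2.2 hp.2
  have hτc := eventually_eq_of_rational_ratio hτ (hΨ.mono fun r hr => hr.1.ne') hD hdense hrat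
  have hswap : Tendsto (Prod.swap : ℝ × ℝ → ℝ × ℝ) (𝓝 (r₀, s₀)) (𝓝 (s₀, r₀)) :=
    continuous_swap.tendsto (r₀, s₀)
  have hσc := eventually_eq_of_rational_ratio hσ (hΦ.mono fun r hr => hr.1.ne')
    (hD.preimage continuous_swap) ((hswap.eventually hdense).mono fun p hp => by
      have := (Homeomorph.prodComm ℝ ℝ).preimage_closure D
      exact this.subset hp) ((hswap.eventually hrat).mono fun p hp hpD => by
      obtain ⟨q, hq⟩ := hp hpD
      exact ⟨q⁻¹, by push_cast; rw [← hq, inv_div]; rfl⟩)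
  rw [hτT] at hτc
  rw [hσS] at hσc
  refine ⟨?_, ?_, ?_⟩
  · filter_upwards [hτc, hΦ] with s h1 h2
    exact ⟨_, h2.2.2.1, h2.2.1, h1 ▸ h2.2.2.2⟩
  · filter_upwards [hσc, hΨ] with s h1 h2
    exact ⟨_, h2.2.2.1, h2.2.1, h1 ▸ h2.2.2.2⟩
  · have h1 := (mem_closure_iff_frequently.1 hdense.self_of_nhds).and_eventually
      (hrat.and (((continuousAt_fst (p := (s₀, r₀))).eventually hτc).and
        ((continuousAt_snd (p := (s₀, r₀))).eventually hσc)))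
    obtain ⟨p, hpD, hp, hp1, hp2⟩ := h1.exists
    rw [← hp1, ← hp2]
    exact hp hpD

end Forward

/-! ### Equality of least periods, and isochronous potentials as single wells. -/

section Isochrony

variable {I : Set ℝ} {V : ℝ → ℝ} {x₀ T : ℝ}

theorem not_const_of_snd_ne_zero {γ : ℝ → ℝ × ℝ} (h : IsTrajectory I V γ) {t : ℝ}
    (ht : (γ t).2 ≠ 0) : ¬ ∃ c, ∀ t, γ t = c := by
  rintro ⟨c, hc⟩
  have h1 := h.hasDerivAt_fst t
  simp only [hc] at h1 ht
  exact ht (h1.unique (hasDerivAt_const t c.1))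

theorem HasPeriod.comp_add {γ : ℝ → ℝ × ℝ} (h : HasPeriod γ T) (a : ℝ) :
    HasPeriod (fun t => γ (t + a)) T := by
  refine ⟨⟨h.1.1, fun t => ?_⟩, fun S hS => h.2 ⟨hS.1, fun t => ?_⟩⟩
  · change γ (t + T + a) = γ (t + a)
    rw [← h.1.2 (t + a)]
    congr 1
    ring
  · have := hS.2 (t - a)
    simp only [sub_add_cancel] at this
    rw [← this]
    congr 1
    ring

/-- If periodicity persists at every period, then a potential with a periodic trajectory around
the bottom of a well is isochronous. -/
theorem exists_isIsochronousWithPeriod (hI : IsOpen I) (hI' : I.OrdConnected)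
    (hV : ContDiffOn ℝ 2 V I) (hend : ∀ c ∈ frontier I, Tendsto V (𝓝[I] c) atTop) (hx₀ : x₀ ∈ I)
    (hmin : IsStrictLocalMin V x₀) (hd : deriv V x₀ = 0)
    (hopen : ∀ T, 0 < T → IsOpen (periodicMomenta I V x₀ T))
    (hne : ∃ T, 0 < T ∧ (periodicMomenta I V x₀ T).Nonempty) :
    ∃ T, 0 < T ∧ IsIsochronousWithPeriod I V T ∧ (periodicMomenta I V x₀ T).Nonempty := by
  obtain ⟨T₀, hT₀, s₀, hs₀, γ₀, hγ₀, hγ₀0, hper₀⟩ := hne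
  obtain ⟨T, hT⟩ := exists_hasPeriod hγ₀.continuous hT₀ hper₀
    (not_const_of_snd_ne_zero hγ₀ (t := 0) (by rw [hγ₀0]; exact hs₀.ne'))
  have hsT : s₀ ∈ periodicMomenta I V x₀ T := ⟨hs₀, γ₀, hγ₀, hγ₀0, hT.1.2⟩
  have hwell := isPeriodicWell_of_isOpen hI hI' hV hend hx₀ hT.1.1 hd (hopen T hT.1.1) ⟨s₀, hsT⟩
  refine ⟨T, hT.1.1, ⟨⟨x₀, hx₀, hmin⟩, fun γ hγ _ hγne => ?_⟩, ⟨s₀, hsT⟩⟩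
  have h0 : γ 0 ≠ (x₀, 0) := fun h0 => hγne ⟨γ 0, hγ.eq_const_of_equilibrium hI hI' hV
    (by rw [h0]) (by rw [h0]; exact hd)⟩
  obtain ⟨s, hs, γ', hγ', hγ'0, hper', t, ht⟩ := hwell.exists_orbit (γ 0) (hγ.mem 0) h0
  have hshift : γ = fun u => γ' (u + t) :=
    hγ.eq_of_apply_eq (hγ'.comp_add t) hI hI' hV (t₀ := 0) (by simp [ht])
  obtain ⟨S, hS⟩ := exists_hasPeriod hγ'.continuous hT.1.1 hper'
    (not_const_of_snd_ne_zero hγ' (t := 0) (by rw [hγ'0]; exact hs.ne'))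
  -- The spreading argument is run again with the least period `S` of the second trajectory, making
  -- the first one `S`-periodic; the two least periods then bound each other.
  have hA := periodicMomenta_eq_Ioi hI hI' hV hend hS.1.1 hd (hopen S hS.1.1)
    ⟨s, hs, γ', hγ', hγ'0, hS.1.2⟩
  obtain ⟨-, γ₁, hγ₁, hγ₁0, hper₁⟩ := (hA.symm ▸ hs₀ : s₀ ∈ periodicMomenta I V x₀ S)
  have h₁ : γ₁ = γ₀ := hγ₁.eq_of_apply_eq hγ₀ hI hI' hV (t₀ := 0) (by rw [hγ₁0, hγ₀0])
  rw [h₁] at hper₁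
  have hTS : T = S := le_antisymm (hT.2 ⟨hS.1.1, hper₁⟩) (hS.2 ⟨hT.1.1, hper'⟩)
  rw [hshift, hTS]
  exact hS.comp_add t

theorem IsStrictLocalMin.deriv_eq_zero {x : ℝ} (h : IsStrictLocalMin V x) :
    deriv V x = 0 := by
  have : IsLocalMin V x := (eventually_nhdsWithin_iff.1 h).mono fun y hy => by
    by_cases hyx : y = x
    · rw [hyx]
    · exact (hy hyx).le
  exact this.deriv_eq_zero

/-- Isochronous potentials are single wells. -/
theorem IsIsochronousWithPeriod.isPeriodicWell (h : IsIsochronousWithPeriod I V T) (hI : IsOpen I)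
    (hI' : I.OrdConnected) (hV : ContDiffOn ℝ 2 V I)
    (hend : ∀ c ∈ frontier I, Tendsto V (𝓝[I] c) atTop) : ∃ x₀, IsPeriodicWell I V x₀ T := by
  obtain ⟨⟨x₀, hx₀, hmin⟩, hiso⟩ := h
  have hd : deriv V x₀ = 0 := hmin.deriv_eq_zero
  have hperT : ∀ (γ : ℝ → ℝ × ℝ) (s S : ℝ), IsTrajectory I V γ → γ 0 = (x₀, s) → s ≠ 0 → 0 < S →
      Function.Periodic γ S → HasPeriod γ T := fun γ s S hγ hγ0 hs hS hper =>
    hiso γ hγ (hper.compact_of_continuous hS.ne' hγ.continuous).isBounded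
      (not_const_of_snd_ne_zero hγ (t := 0) (by rwa [hγ0]))
  obtain ⟨S, hS, s, hs, γ, hγ, hγ0, hper⟩ := exists_mem_periodicMomenta hI hI' hV hx₀ hmin
  have hT := hperT γ s S hγ hγ0 hs.ne' hS hper
  refine ⟨x₀, isPeriodicWell_of_isOpen hI hI' hV hend hx₀ hT.1.1 hd ?_
    ⟨s, hs, γ, hγ, hγ0, hT.1.2⟩⟩
  rw [isOpen_iff_eventually]
  rintro r ⟨hr, δ, hδ, hδ0, hδT⟩
  -- Nearby trajectories are periodic with some period, hence bounded, and isochrony forces that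
  -- period to be `T`; this gives openness.
  obtain ⟨Φ, τ, -, -, -, -, hΦ⟩ := hδ.exists_period_family hI hI' hV hT.1.1 hδT hδ0 hr.ne'
  filter_upwards [hΦ, lt_mem_nhds hr] with u hu hu0
  exact ⟨hu0, _, hu.2.2.1, hu.2.1, (hperT _ u (τ u) hu.2.2.1 hu.2.1 hu0.ne' hu.1 hu.2.2.2).1.2⟩

end Isochrony

theorem isStrictLocalMin_of_separable {Va Vb : ℝ → ℝ} {z : Phase2}
    (h : IsStrictLocalMin (separableHamiltonian Va Vb) z) :
    IsStrictLocalMin Va z.1.1 ∧ IsStrictLocalMin Vb z.2.1 := by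
  have h' := eventually_nhdsWithin_iff.1 h
  constructor <;> refine eventually_nhdsWithin_iff.2 ?_
  · have hc : Tendsto (fun x : ℝ => (((x, z.1.2), z.2) : Phase2)) (𝓝 z.1.1) (𝓝 z) :=
      Continuous.tendsto (by fun_prop) z.1.1
    filter_upwards [hc.eventually h'] with x hx hne
    have := hx fun he => hne (congrArg (fun z : Phase2 => z.1.1) he)
    simp only [separableHamiltonian] at this
    linarith
  · have hc : Tendsto (fun x : ℝ => ((z.1, (x, z.2.2)) : Phase2)) (𝓝 z.2.1) (𝓝 z) :=
      Continuous.tendsto (by fun_prop) z.2.1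
    filter_upwards [hc.eventually h'] with x hx hne
    have := hx fun he => hne (congrArg (fun z : Phase2 => z.2.1) he)
    simp only [separableHamiltonian] at this
    linarith

/-- Maximal superintegrability implies isochrony with commensurable periods. -/
theorem MaximallySuperintegrable.isochronous {I J : Set ℝ} {Va Vb : ℝ → ℝ}
    (h : MaximallySuperintegrable I J Va Vb) (hI : IsOpen I) (hI' : I.OrdConnected)
    (hJ : IsOpen J) (hJ' : J.OrdConnected) (hVa : ContDiffOn ℝ 2 Va I) (hVb : ContDiffOn ℝ 2 Vb J)
    (hIa : ∀ c ∈ frontier I, Tendsto Va (𝓝[I] c) atTop)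
    (hJb : ∀ c ∈ frontier J, Tendsto Vb (𝓝[J] c) atTop)
    (hmin : ∃ z ∈ phaseSpace I J, IsStrictLocalMin (separableHamiltonian Va Vb) z) :
    ∃ Ta Tb : ℝ, IsIsochronousWithPeriod I Va Ta ∧ IsIsochronousWithPeriod J Vb Tb ∧
      ∃ q : ℚ, Ta / Tb = q := by
  obtain ⟨Q, hQ, hind⟩ := h
  obtain ⟨z, hz, hzmin⟩ := hmin
  obtain ⟨hma, hmb⟩ := isStrictLocalMin_of_separable hzmin
  obtain ⟨hxI, hyJ⟩ := mem_phaseSpace.1 hz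
  have hnea := exists_mem_periodicMomenta hI hI' hVa hxI hma
  have hneb := exists_mem_periodicMomenta hJ hJ' hVb hyJ hmb
  have key := fun {T S s r : ℝ} (hT : 0 < T) (hS : 0 < S)
      (hs : s ∈ periodicMomenta I Va z.1.1 T) (hr : r ∈ periodicMomenta J Vb z.2.1 S) =>
    let ⟨hs0, _, h1, h2, h3⟩ := hs
    let ⟨hr0, _, h1', h2', h3'⟩ := hr
    eventually_periodic_of_superintegrable hI hI' hJ hJ' hVa hVb hQ hind hT hS hs0.ne' hr0.ne'
      h1 h2 h3 h1' h2' h3'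
  -- Openness for one factor needs only some periodic trajectory of the other as a partner.
  obtain ⟨Ta, hTa, hisoa, sa, hsa⟩ := exists_isIsochronousWithPeriod hI hI' hVa hIa hxI hma
    hma.deriv_eq_zero (fun T hT => isOpen_iff_eventually.2 fun s hs => by
      obtain ⟨S, hS, r, hr⟩ := hneb
      filter_upwards [(key hT hS hs hr).1, lt_mem_nhds hs.1] with u hu hu0 using ⟨hu0, hu⟩) hnea
  obtain ⟨Tb, hTb, hisob, sb, hsb⟩ := exists_isIsochronousWithPeriod hJ hJ' hVb hJb hyJ hmb
    hmb.deriv_eq_zero (fun S hS => isOpen_iff_eventually.2 fun r hr => by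
      filter_upwards [(key hTa hS hsa hr).2.1, lt_mem_nhds hr.1] with u hu hu0 using ⟨hu0, hu⟩) hneb
  exact ⟨Ta, Tb, hisoa, hisob, (key hTa hTb hsa hsb).2.2⟩

/-- The integral over a parameter of a `C¹` function is `C¹`. -/
theorem contDiff_one_intervalIntegral {E G : Type*} [NormedAddCommGroup E] [NormedSpace ℝ E]
    [ProperSpace E] [NormedAddCommGroup G] [NormedSpace ℝ G] [CompleteSpace G]
    {F : ℝ × E → G} (hF : ContDiff ℝ 1 F) (a b : ℝ) :
    ContDiff ℝ 1 fun w => ∫ t in a..b, F (t, w) := by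
  let F' : E → ℝ → E →L[ℝ] G := fun w t => (fderiv ℝ F (t, w)).comp (ContinuousLinearMap.inr ℝ ℝ E)
  have hF'c : Continuous F'.uncurry :=
    ((hF.continuous_fderiv one_ne_zero).comp (continuous_snd.prodMk continuous_fst)).clm_comp
      continuous_const
  have hdF : ∀ w t, HasFDerivAt (fun w => F (t, w)) (F' w t) w := fun w t =>
    ((hF.differentiable one_ne_zero) (t, w)).hasFDerivAt.comp w (hasFDerivAt_prodMk_right t w)
  have hFt : ∀ w, Continuous fun t => F (t, w) := fun w =>
    hF.continuous.comp (continuous_id.prodMk continuous_const)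
  have hd : ∀ w, HasFDerivAt (fun w => ∫ t in a..b, F (t, w)) (∫ t in a..b, F' w t) w := by
    intro w
    obtain ⟨C, hC⟩ := ((isCompact_closedBall w 1).prod (isCompact_uIcc (a := a) (b := b))
      ).exists_bound_of_continuousOn hF'c.continuousOn
    refine intervalIntegral.hasFDerivAt_integral_of_dominated_of_fderiv_le
      (bound := fun _ => C) (Metric.closedBall_mem_nhds w one_pos)
      (Eventually.of_forall fun w => (hFt w).aestronglyMeasurable)
      ((hFt w).intervalIntegrable _ _)
      (hF'c.comp (continuous_const.prodMk continuous_id)).aestronglyMeasurable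
      (Eventually.of_forall fun t ht x hx => hC (x, t) ⟨hx, uIoc_subset_uIcc ht⟩)
      (by simp) (Eventually.of_forall fun t _ x _ => hdF x t)
  exact contDiff_one_iff_hasFDerivAt.2 ⟨_,
    intervalIntegral.continuous_parametric_intervalIntegral_of_continuous' hF'c a b, hd⟩

/-! ### The rotating function of an isochronous well. -/

section Angle

variable {I : Set ℝ} {V : ℝ → ℝ} {x₀ T : ℝ}

theorem IsPeriodicWell.exists_trajectory (hw : IsPeriodicWell I V x₀ T) {w : ℝ × ℝ}
    (hwI : w.1 ∈ I) : ∃ γ, IsTrajectory I V γ ∧ γ 0 = w ∧ Function.Periodic γ T := by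
  by_cases h : w = (x₀, 0)
  · refine ⟨fun _ => w, fun t => ⟨hwI, (hasDerivAt_const t w).congr_deriv ?_⟩, rfl, fun t => rfl⟩
    simp [h, hw.deriv_eq_zero, Prod.ext_iff]
  · obtain ⟨s, hs, γ, hγ, hγ0, hper, t, ht⟩ := hw.exists_orbit w hwI h
    refine ⟨_, hγ.comp_add t, by simpa using ht, fun u => ?_⟩
    change γ (u + T + t) = γ (u + t)
    rw [← hper (u + t)]
    congr 1
    ring

/-- Both factors are odd about `T / 2`, so the integral is twice that over the half period, where
neither factor changes sign. It is meant for the momentum measured from a turning point. -/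
theorem integral_mul_sin_ne_zero {P : ℝ → ℝ} (hc : Continuous P) (hT : 0 < T)
    (hsymm : ∀ t, P (T - t) = -P t) (hne : ∀ t ∈ Ioo 0 (T / 2), P t ≠ 0) :
    ∫ t in (0 : ℝ)..T, P t * Real.sin (2 * Real.pi / T * t) ≠ 0 := by
  set g : ℝ → ℝ := fun t => P t * Real.sin (2 * Real.pi / T * t) with hg
  have hgc : Continuous g := hc.mul (Real.continuous_sin.comp (continuous_const.mul continuous_id))
  have hgi : ∀ a b, IntervalIntegrable g MeasureTheory.volume a b := fun a b =>
    hgc.intervalIntegrable a b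
  have hgs : ∀ t, g (T - t) = g t := by
    intro t
    simp only [hg, hsymm]
    rw [show 2 * Real.pi / T * (T - t) = 2 * Real.pi - 2 * Real.pi / T * t by field_simp,
      Real.sin_two_pi_sub]
    ring
  have hhalf : ∫ t in (0 : ℝ)..T, g t = 2 * ∫ t in (0 : ℝ)..(T / 2), g t := by
    rw [← intervalIntegral.integral_add_adjacent_intervals (hgi 0 (T / 2)) (hgi (T / 2) T)]
    have h1 := intervalIntegral.integral_comp_sub_left g T (a := 0) (b := T / 2)
    simp only [hgs, sub_zero] at h1
    rw [show T - T / 2 = T / 2 by ring] at h1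
    rw [← h1]
    ring
  rw [hhalf]
  have hsin : ∀ t ∈ Ioo 0 (T / 2), 0 < Real.sin (2 * Real.pi / T * t) := by
    intro t ht
    have hpi := Real.pi_pos
    refine Real.sin_pos_of_pos_of_lt_pi (by have := ht.1; positivity) ?_
    have h1 : 2 * Real.pi / T * t < 2 * Real.pi / T * (T / 2) :=
      mul_lt_mul_of_pos_left ht.2 (by positivity)
    rwa [show 2 * Real.pi / T * (T / 2) = Real.pi by field_simp] at h1
  have hsign : (∀ t ∈ Ioo 0 (T / 2), 0 < P t) ∨ (∀ t ∈ Ioo 0 (T / 2), P t < 0) := by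
    by_contra hcon
    push Not at hcon
    obtain ⟨⟨a, ha, ha'⟩, b, hb, hb'⟩ := hcon
    obtain ⟨t, ht, h0⟩ := isPreconnected_Ioo.intermediate_value ha hb hc.continuousOn ⟨ha', hb'⟩
    exact hne t ht h0
  refine mul_ne_zero two_ne_zero ?_
  rcases hsign with h | h
  · exact (intervalIntegral.intervalIntegral_pos_of_pos_on (hgi _ _)
      (fun t ht => mul_pos (h t ht) (hsin t ht)) (half_pos hT)).ne'
  · have := intervalIntegral.intervalIntegral_pos_of_pos_on (hgi 0 (T / 2)).neg
      (fun t ht => neg_pos.2 (mul_neg_of_neg_of_pos (h t ht) (hsin t ht))) (half_pos hT)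
    simp only [Pi.neg_apply, intervalIntegral.integral_neg] at this
    linarith

/-- In an isochronous well there is a `C¹` function that rotates uniformly along trajectories and
vanishes only at the equilibrium. -/
theorem IsPeriodicWell.exists_rotating_function (hw : IsPeriodicWell I V x₀ T) (hI : IsOpen I)
    (hI' : I.OrdConnected) (hV : ContDiffOn ℝ 2 V I) (hiso : IsIsochronousWithPeriod I V T) :
    ∃ Z : ℝ × ℝ → ℂ, ContDiffOn ℝ 1 Z (I ×ˢ univ) ∧
      (∀ γ, IsTrajectory I V γ → ∀ t,
        Z (γ t) = Complex.exp (((2 * Real.pi / T * t : ℝ) : ℂ) * Complex.I) * Z (γ 0)) ∧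
      ∀ w : ℝ × ℝ, w.1 ∈ I → w ≠ (x₀, 0) → Z w ≠ 0 := by
  classical
  have hT := hw.pos
  have hex : ∀ w : ℝ × ℝ, ∃ γ, w.1 ∈ I → IsTrajectory I V γ ∧ γ 0 = w ∧ Function.Periodic γ T :=
    fun w => by
      by_cases hwI : w.1 ∈ I
      · obtain ⟨γ, h⟩ := hw.exists_trajectory hwI
        exact ⟨γ, fun _ => h⟩
      · exact ⟨fun _ => w, fun h => absurd h hwI⟩
  choose φ hφ using hex
  have hφeq : ∀ γ, IsTrajectory I V γ → φ (γ 0) = γ := fun γ hγ =>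
    (hφ _ (hγ.mem 0)).1.eq_of_apply_eq hγ hI hI' hV (t₀ := 0) (hφ _ (hγ.mem 0)).2.1
  let e : ℝ → ℂ := fun s => Complex.exp (((-(2 * Real.pi / T * s) : ℝ) : ℂ) * Complex.I)
  have hec : ContDiff ℝ 1 e :=
    Complex.contDiff_exp.comp ((Complex.ofRealCLM.contDiff.comp
      (contDiff_const.mul contDiff_id).neg).mul contDiff_const)
  -- This is the unnormalised first Fourier coefficient of the momentum along the trajectory through
  -- `w`; a time shift only changes its phase.
  let Z : ℝ × ℝ → ℂ := fun w => ∫ s in (0 : ℝ)..T, (((φ w s).2 : ℝ) : ℂ) * e s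
  have hZeq : ∀ γ, IsTrajectory I V γ → ∀ t,
      Z (γ t) = ∫ s in (0 : ℝ)..T, (((γ (s + t)).2 : ℝ) : ℂ) * e s := by
    intro γ hγ t
    have := hφeq _ (hγ.comp_add t)
    simp only [zero_add] at this
    simp only [Z, this]
  have hrot : ∀ γ, IsTrajectory I V γ → ∀ t,
      Z (γ t) = Complex.exp (((2 * Real.pi / T * t : ℝ) : ℂ) * Complex.I) * Z (γ 0) := by
    intro γ hγ t
    have hper : Function.Periodic γ T := by
      have := (hφ _ (hγ.mem 0)).2.2
      rwa [hφeq γ hγ] at this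
    rw [hZeq γ hγ t, hZeq γ hγ 0]
    set G : ℝ → ℂ := fun s => (((γ s).2 : ℝ) : ℂ) * e s
    have hep : Function.Periodic e T := by
      intro s
      simp only [e]
      rw [Complex.exp_eq_exp_iff_exists_int]
      refine ⟨-1, ?_⟩
      have : (T : ℂ) ≠ 0 := by exact_mod_cast hT.ne'
      push_cast
      field_simp
      ring
    have hGper : Function.Periodic G T := fun s => by simp only [G, hper s, hep s]
    have h1 : ∀ s, (((γ (s + t)).2 : ℝ) : ℂ) * e s
        = Complex.exp (((2 * Real.pi / T * t : ℝ) : ℂ) * Complex.I) * G (s + t) := by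
      intro s
      have : e s = Complex.exp (((2 * Real.pi / T * t : ℝ) : ℂ) * Complex.I) * e (s + t) := by
        simp only [e]
        rw [← Complex.exp_add]
        congr 1
        push_cast
        ring
      rw [this]
      simp only [G]
      ring
    simp only [h1, intervalIntegral.integral_const_mul, add_zero]
    congr 1
    rw [intervalIntegral.integral_comp_add_right, zero_add, add_comm T t,
      hGper.intervalIntegral_add_eq t 0, zero_add]
  refine ⟨Z, ?_, hrot, ?_⟩
  · rintro w ⟨hwI, -⟩
    refine ContDiffAt.contDiffWithinAt ?_
    -- Any energy above that of `w` would do: the nearby trajectories then stay in one compact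
    -- interval, where a truncated `C¹` flow represents them, even if `w` is the equilibrium.
    set E := hamiltonian1 V w + 1
    obtain ⟨α, β, hαβ, hsub, hE⟩ := hw.exists_Icc E
    obtain ⟨F⟩ := exists_truncatedFlow hI hV hαβ hsub
    have hHc : ContinuousAt (hamiltonian1 V) w :=
      (hasFDerivAt_hamiltonian1 ((hV.differentiableOn two_ne_zero).differentiableAt
        (hI.mem_nhds hwI))).continuousAt
    have hev : ∀ᶠ w' : ℝ × ℝ in 𝓝 w, w'.1 ∈ I ∧ hamiltonian1 V w' < E :=
      Eventually.and (continuousAt_fst.preimage_mem_nhds (hI.mem_nhds hwI))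
        (hHc.eventually (gt_mem_nhds (by simp only [E]; linarith)))
    have hZF : Z =ᶠ[𝓝 w] fun w' => ∫ s in (0 : ℝ)..T, (((F.flow s w').2 : ℝ) : ℂ) * e s := by
      filter_upwards [hev] with w' ⟨hw'I, hw'E⟩
      obtain ⟨h1, h2, -⟩ := hφ w' hw'I
      have h3 := F.eq_flow_of_isTrajectory h1 fun t => hE _ (h1.mem t) (by
        have := h1.hamiltonian1_eq hI hV t 0
        rw [h2] at this
        rw [← this, hamiltonian1] at hw'E
        nlinarith [sq_nonneg (φ w' t).2])
      rw [h2] at h3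
      simp only [Z, h3]
    refine ContDiffAt.congr_of_eventuallyEq (ContDiff.contDiffAt ?_) hZF
    exact contDiff_one_intervalIntegral
      (F := fun q : ℝ × (ℝ × ℝ) => (((F.flow q.1 q.2).2 : ℝ) : ℂ) * e q.1)
      ((Complex.ofRealCLM.contDiff.comp (contDiff_snd.comp F.contDiff_flow)).mul
        (hec.comp contDiff_fst)) 0 T
  · intro w hwI hne hzero
    obtain ⟨s, hs, γ, hγ, hγ0, hper, t, ht⟩ := hw.exists_orbit w hwI hne
    obtain ⟨α, -, a, -, -, -, ha, -⟩ := hγ.exists_range_fst_eq_Icc hT.ne' hper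
    -- A zero of `Z` propagates along the trajectory to a turning point. There the imaginary part is
    -- minus the sine integral, and a zero of the momentum before `T / 2` would give a period
    -- shorter than the least one.
    have hZa : Z (γ a) = 0 := by
      rw [hrot γ hγ a]
      have := hrot γ hγ t
      rw [ht, hzero, eq_comm] at this
      rw [(mul_eq_zero.1 this).resolve_left (Complex.exp_ne_zero _), mul_zero]
    have hδ := hγ.comp_add a
    have hδ0 : (γ (0 + a)).2 = 0 := by rw [zero_add, ha]
    have hγconst := not_const_of_snd_ne_zero hγ (t := 0) (by rw [hγ0]; exact hs.ne')
    have hminper := hiso.2 γ hγ (hper.compact_of_continuous hT.ne' hγ.continuous).isBounded hγconst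
    have hminδ := hminper.comp_add a
    refine integral_mul_sin_ne_zero (P := fun t => (γ (t + a)).2) hδ.continuous_snd hT
      (fun t => ?_) (fun t ht hPt => ?_) ?_
    · have h1 := hδ.apply_reflect hI hI' hV (a := 0) hδ0 t
      have h2 := hminδ.1.2 (2 * 0 - t)
      simp only at h1 h2
      rw [h1] at h2
      have h3 := congrArg Prod.snd h2
      simp only at h3
      rw [← h3]
      congr 3
      ring
    · have h1 := hδ.periodic_of_turning hI hI' hV hδ0 hPt
      have := hminδ.2 ⟨by linarith [ht.1], h1⟩
      linarith [ht.2]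
    · have hint : IntervalIntegrable (fun s => (((γ (s + a)).2 : ℝ) : ℂ) * e s)
          MeasureTheory.volume 0 T :=
        ((Complex.continuous_ofReal.comp hδ.continuous_snd).mul hec.continuous).intervalIntegrable
          _ _
      have h1 := hZeq γ hγ a
      rw [hZa] at h1
      have h2 := Complex.imCLM.intervalIntegral_comp_comm hint
      rw [← h1] at h2
      simp only [Complex.imCLM_apply, Complex.zero_im, Complex.im_ofReal_mul] at h2
      have h3 : ∀ s, (e s).im = -Real.sin (2 * Real.pi / T * s) := fun s => by
        simp only [e]
        rw [Complex.exp_ofReal_mul_I_im, Real.sin_neg]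
      simp only [h3, mul_neg, intervalIntegral.integral_neg] at h2
      linarith

end Angle

/-! ### Construction of the third integral. -/

section Backward

variable {I J : Set ℝ} {Va Vb : ℝ → ℝ}

theorem IsPeriodicWell.hamiltonianField_ne_zero {V : ℝ → ℝ} {x₀ T : ℝ}
    (hw : IsPeriodicWell I V x₀ T) {w : ℝ × ℝ} (hwI : w.1 ∈ I) (hne : w ≠ (x₀, 0)) :
    hamiltonianField V w ≠ 0 := by
  intro h
  have h1 : w.2 = 0 := congrArg Prod.fst h
  have h2 : deriv V w.1 = 0 := neg_eq_zero.1 (congrArg Prod.snd h)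
  by_cases hx : w.1 = x₀
  · exact hne (Prod.ext hx h1)
  · exact hw.deriv_ne_zero _ hwI hx h2

theorem eventually_add_ne_zero (p : ℝ) : ∀ᶠ ε in 𝓝[≠] (0 : ℝ), p + ε ≠ 0 := by
  rcases eq_or_ne p 0 with rfl | hp
  · filter_upwards [self_mem_nhdsWithin] with ε hε
    simpa using hε
  · exact nhdsWithin_le_nhds ((continuousAt_const.add continuousAt_id).eventually_ne (by simpa using hp))

/-- A nontrivial sinusoid has only simple zeros: if `c` is real, the derivative at zero is `k * c.re
≠ 0`. -/
theorem eventually_im_exp_mul_ne_zero {k : ℝ} (hk : k ≠ 0) {c : ℂ} (hc : c ≠ 0) :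
    ∀ᶠ t in 𝓝[≠] (0 : ℝ), (Complex.exp (((k * t : ℝ) : ℂ) * Complex.I) * c).im ≠ 0 := by
  have him : ∀ t : ℝ, (Complex.exp (((k * t : ℝ) : ℂ) * Complex.I) * c).im
      = Real.cos (k * t) * c.im + Real.sin (k * t) * c.re := fun t => by
    rw [Complex.mul_im, Complex.exp_ofReal_mul_I_re, Complex.exp_ofReal_mul_I_im]
  have hd : HasDerivAt (fun t : ℝ => Real.cos (k * t) * c.im + Real.sin (k * t) * c.re)
      (k * c.re) 0 := by
    have h1 := (hasDerivAt_id (0 : ℝ)).const_mul k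
    refine ((h1.cos.mul_const c.im).add (h1.sin.mul_const c.re)).congr_deriv ?_
    simp
  simp only [him]
  by_cases h : c.im = 0
  · have hre : c.re ≠ 0 := fun hre => hc (Complex.ext hre h)
    have := hd.eventually_ne (mul_ne_zero hk hre) (c := 0)
    exact this
  · refine nhdsWithin_le_nhds (hd.continuousAt.eventually_ne ?_)
    simpa using h

/-- Isochrony with commensurable periods implies maximal superintegrability. -/
theorem maximallySuperintegrable_of_isochronous (hI : IsOpen I) (hI' : I.OrdConnected)
    (hJ : IsOpen J) (hJ' : J.OrdConnected) (hVa : ContDiffOn ℝ 2 Va I) (hVb : ContDiffOn ℝ 2 Vb J)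
    (hIa : ∀ c ∈ frontier I, Tendsto Va (𝓝[I] c) atTop)
    (hJb : ∀ c ∈ frontier J, Tendsto Vb (𝓝[J] c) atTop) {Ta Tb : ℝ}
    (ha : IsIsochronousWithPeriod I Va Ta) (hb : IsIsochronousWithPeriod J Vb Tb) {q : ℚ}
    (hq : Ta / Tb = q) : MaximallySuperintegrable I J Va Vb := by
  obtain ⟨x₀, hwa⟩ := ha.isPeriodicWell hI hI' hVa hIa
  obtain ⟨y₀, hwb⟩ := hb.isPeriodicWell hJ hJ' hVb hJb
  obtain ⟨Za, hZa, hrota, hnea⟩ := hwa.exists_rotating_function hI hI' hVa ha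
  obtain ⟨Zb, hZb, hrotb, hneb⟩ := hwb.exists_rotating_function hJ hJ' hVb hb
  have hTa := hwa.pos
  have hTb := hwb.pos
  have hq0 : 0 < q := by
    have : (0 : ℝ) < q := hq ▸ div_pos hTa hTb
    exact_mod_cast this
  obtain ⟨n, m, hn, hm, hnm⟩ : ∃ n m : ℕ, n ≠ 0 ∧ m ≠ 0 ∧ (n : ℝ) / Ta = m / Tb := by
    refine ⟨q.num.toNat, q.den, ?_, q.den_ne_zero, ?_⟩
    · have := Rat.num_pos.2 hq0
      omega
    · have h1 : ((q.num.toNat : ℤ) : ℝ) = q.num := by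
        rw [Int.toNat_of_nonneg (Rat.num_pos.2 hq0).le]
      have h2 : (q : ℝ) = q.num / q.den := Rat.cast_def q
      have h3 : (q.den : ℝ) ≠ 0 := by exact_mod_cast q.den_ne_zero
      rw [h2] at hq
      have h4 : (q.num.toNat : ℝ) = q.num := by exact_mod_cast h1
      rw [h4]
      field_simp at hq ⊢
      linarith
  have hM := isOpen_phaseSpace hI hJ
  -- The exponents equalise the two angular speeds and the conjugate reverses one of them, so `c` is
  -- invariant under the joint flow but turns with speed `k` along the first factor alone.
  let c : Phase2 → ℂ := fun z => Za z.1 ^ n * (starRingEnd ℂ) (Zb z.2) ^ m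
  let Q : Phase2 → ℝ := fun z => (c z).re
  have hQc : ContDiffOn ℝ 1 Q (phaseSpace I J) := by
    have h1 : ContDiffOn ℝ 1 (fun z : Phase2 => Za z.1) (phaseSpace I J) :=
      hZa.comp contDiff_fst.contDiffOn fun z hz => hz.1
    have h2 : ContDiffOn ℝ 1 (fun z : Phase2 => Zb z.2) (phaseSpace I J) :=
      hZb.comp contDiff_snd.contDiffOn fun z hz => hz.2
    have h3 : ContDiffOn ℝ 1 (fun z : Phase2 => (starRingEnd ℂ) (Zb z.2)) (phaseSpace I J) :=
      Complex.conjCLE.contDiff.comp_contDiffOn h2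
    exact Complex.reCLM.contDiff.comp_contDiffOn ((h1.pow n).mul (h3.pow m))
  have hQd : ∀ z ∈ phaseSpace I J, HasFDerivAt Q (fderiv ℝ Q z) z := fun z hz =>
    ((hQc.differentiableOn one_ne_zero).differentiableAt (hM.mem_nhds hz)).hasFDerivAt
  set k : ℝ := n * (2 * Real.pi / Ta) with hk
  have hk0 : k ≠ 0 := by
    have := Real.pi_pos
    have : (n : ℝ) ≠ 0 := by exact_mod_cast hn
    positivity
  have hkb : k = m * (2 * Real.pi / Tb) := by
    rw [hk, mul_div_left_comm, mul_div_left_comm (m : ℝ), hnm]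
  have hca : ∀ γ, IsTrajectory I Va γ → ∀ (w : ℝ × ℝ) t,
      c (γ t, w) = Complex.exp (((k * t : ℝ) : ℂ) * Complex.I) * c (γ 0, w) := by
    intro γ hγ w t
    simp only [c, hrota γ hγ t, mul_pow, ← Complex.exp_nat_mul]
    rw [hk]
    push_cast
    ring_nf
  have hcb : ∀ δ, IsTrajectory J Vb δ → ∀ (w : ℝ × ℝ) t,
      c (w, δ t) = Complex.exp (((-(k * t) : ℝ) : ℂ) * Complex.I) * c (w, δ 0) := by
    intro δ hδ w t
    simp only [c, hrotb δ hδ t, mul_pow, map_mul, ← Complex.exp_conj, Complex.conj_ofReal,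
      Complex.conj_I, ← Complex.exp_nat_mul]
    rw [hkb]
    push_cast
    ring_nf
  have htraja : ∀ z ∈ phaseSpace I J, ∃ γ, IsTrajectory I Va γ ∧ γ 0 = z.1 := fun z hz =>
    let ⟨γ, h1, h2, _⟩ := hwa.exists_trajectory (mem_phaseSpace.1 hz).1
    ⟨γ, h1, h2⟩
  have hda : ∀ x ∈ I, DifferentiableAt ℝ Va x := fun x hx =>
    (hVa.differentiableOn two_ne_zero).differentiableAt (hI.mem_nhds hx)
  have hdb : ∀ x ∈ J, DifferentiableAt ℝ Vb x := fun x hx =>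
    (hVb.differentiableOn two_ne_zero).differentiableAt (hJ.mem_nhds hx)
  -- Differentiating `Re (exp (i k t) c)` at zero shows that, off the equilibria, independence
  -- amounts to `c` having nonzero imaginary part.
  have hderiva : ∀ z ∈ phaseSpace I J,
      fderiv ℝ Q z (hamiltonianField Va z.1, 0) = -(k * (c z).im) := by
    intro z hz
    obtain ⟨γ, hγ, hγ0⟩ := htraja z hz
    have h1 : HasDerivAt (fun t => Q (γ t, z.2)) (fderiv ℝ Q z (hamiltonianField Va z.1, 0)) 0 := by
      have h2 := (hγ 0).2.prodMk (hasDerivAt_const (0 : ℝ) z.2)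
      have h3 : HasFDerivAt Q (fderiv ℝ Q z) (γ 0, z.2) := by rw [hγ0]; exact hQd z hz
      have h4 := h3.comp_hasDerivAt (0 : ℝ) h2
      rw [hγ0] at h4
      exact h4
    have h5 : (fun t => Q (γ t, z.2))
        = fun t : ℝ => Real.cos (k * t) * (c z).re - Real.sin (k * t) * (c z).im := by
      funext t
      simp only [Q]
      rw [hca γ hγ z.2 t, hγ0, Complex.mul_re, Complex.exp_ofReal_mul_I_re,
        Complex.exp_ofReal_mul_I_im]
    rw [h5] at h1
    have h6 := (hasDerivAt_id (0 : ℝ)).const_mul k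
    have h7 := (h6.cos.mul_const (c z).re).sub (h6.sin.mul_const (c z).im)
    rw [h1.unique h7]
    simp
  have hbr : ∀ z ∈ phaseSpace I J, poissonBracket Q (separableHamiltonian Va Vb) z = 0 := by
    intro z hz
    have hzI := mem_phaseSpace.1 hz
    obtain ⟨γ, hγ, hγ0⟩ := htraja z hz
    obtain ⟨δ, hδ, hδ0, -⟩ := hwb.exists_trajectory hzI.2
    rw [poissonBracket_separableHamiltonian (hda _ hzI.1) (hdb _ hzI.2), ← map_add,
      Prod.mk_add_mk, add_zero, zero_add]
    have h1 : HasDerivAt (fun t => Q (γ t, δ t))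
        (fderiv ℝ Q z (hamiltonianField Va z.1, hamiltonianField Vb z.2)) 0 := by
      have h2 := (hγ 0).2.prodMk (hδ 0).2
      have h3 : HasFDerivAt Q (fderiv ℝ Q z) (γ 0, δ 0) := by rw [hγ0, hδ0]; exact hQd z hz
      have h4 := h3.comp_hasDerivAt (0 : ℝ) h2
      rw [hγ0, hδ0] at h4
      exact h4
    have h5 : (fun t => Q (γ t, δ t)) = fun _ => Q z := by
      funext t
      have : c (γ t, δ t) = c z := by
        rw [hca γ hγ, hcb δ hδ, ← mul_assoc, ← Complex.exp_add, hγ0, hδ0]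
        have : ((k * t : ℝ) : ℂ) * Complex.I + ((-(k * t) : ℝ) : ℂ) * Complex.I = 0 := by
          push_cast; ring
        rw [this, Complex.exp_zero, one_mul]
      simp only [Q, this]
    rw [h5] at h1
    exact h1.unique (hasDerivAt_const _ _)
  refine ⟨Q, ⟨hQc, hbr⟩, ?_⟩
  set L := {z ∈ phaseSpace I J | LinearIndependent ℝ (fun i => fderiv ℝ ((![fun z =>
    hamiltonian1 Va z.1, fun z => hamiltonian1 Vb z.2, Q] : Fin 3 → Phase2 → ℝ) i) z)}
  have hL : ∀ z ∈ phaseSpace I J, z.1 ≠ (x₀, 0) → z.2 ≠ (y₀, 0) → (c z).im ≠ 0 → z ∈ L := by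
    intro z hz h1 h2 h3
    have hzI := mem_phaseSpace.1 hz
    refine ⟨hz, (linearIndependent_differentials_iff (hda _ hzI.1) (hdb _ hzI.2)
      (hwa.hamiltonianField_ne_zero hzI.1 h1) (hwb.hamiltonianField_ne_zero hzI.2 h2)
      (hbr z hz)).2 ?_⟩
    rw [hderiva z hz]
    exact neg_ne_zero.2 (mul_ne_zero hk0 h3)
  -- Away from the equilibria `c ≠ 0`, and moving the first factor for an arbitrarily short time
  -- makes its imaginary part nonzero.
  have hN : ∀ z ∈ phaseSpace I J, z.1 ≠ (x₀, 0) → z.2 ≠ (y₀, 0) → z ∈ closure L := by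
    intro z hz h1 h2
    have hzI := mem_phaseSpace.1 hz
    obtain ⟨γ, hγ, hγ0⟩ := htraja z hz
    have hcz : c z ≠ 0 := mul_ne_zero (pow_ne_zero _ (hnea _ hzI.1 h1))
      (pow_ne_zero _ ((map_ne_zero _).2 (hneb _ hzI.2 h2)))
    have ht : Tendsto (fun t => (γ t, z.2)) (𝓝[≠] 0) (𝓝 z) := by
      have : Tendsto (fun t => (γ t, z.2)) (𝓝 0) (𝓝 (γ 0, z.2)) :=
        (hγ.continuous.prodMk continuous_const).tendsto 0
      rw [hγ0] at this
      exact this.mono_left nhdsWithin_le_nhds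
    refine mem_closure_of_tendsto ht ?_
    have hev : ∀ᶠ t in 𝓝[≠] (0 : ℝ), γ t ≠ (x₀, 0) := nhdsWithin_le_nhds
      (hγ.continuous.continuousAt.eventually_ne (by rwa [hγ0]))
    filter_upwards [eventually_im_exp_mul_ne_zero hk0 hcz, hev] with t h3 h4
    refine hL _ (mem_phaseSpace.2 ⟨hγ.mem t, hzI.2⟩) h4 h2 ?_
    rw [hca γ hγ, hγ0]
    exact h3
  intro z hz
  have hzI := mem_phaseSpace.1 hz
  rw [← closure_closure]
  -- Points over an equilibrium of either factor are approached by a small shift of both momenta,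
  -- which makes each of them nonzero.
  have ht : Tendsto (fun ε : ℝ => (((z.1.1, z.1.2 + ε), (z.2.1, z.2.2 + ε)) : Phase2)) (𝓝[≠] 0)
      (𝓝 z) := by
    have hc : Continuous fun ε : ℝ => (((z.1.1, z.1.2 + ε), (z.2.1, z.2.2 + ε)) : Phase2) := by
      fun_prop
    have := hc.tendsto 0
    simp only [add_zero] at this
    exact this.mono_left nhdsWithin_le_nhds
  refine mem_closure_of_tendsto ht ?_
  filter_upwards [eventually_add_ne_zero z.1.2, eventually_add_ne_zero z.2.2] with ε h1 h2
  exact hN _ (mem_phaseSpace.2 hzI) (fun h => h1 (congrArg Prod.snd h))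
    (fun h => h2 (congrArg Prod.snd h))

end Backward

theorem theorem1 (I J : Set ℝ)
    (hI : IsOpen I) (hI' : I.OrdConnected) (hJ : IsOpen J) (hJ' : J.OrdConnected)
    (Va Vb : ℝ → ℝ) (hVa : ContDiffOn ℝ 2 Va I) (hVb : ContDiffOn ℝ 2 Vb J)
    (hIa : ∀ c ∈ frontier I, Tendsto Va (𝓝[I] c) atTop)
    (hJb : ∀ c ∈ frontier J, Tendsto Vb (𝓝[J] c) atTop)
    (hmin : ∃ z ∈ phaseSpace I J, IsStrictLocalMin (separableHamiltonian Va Vb) z) :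
    MaximallySuperintegrable I J Va Vb ↔
      ∃ Ta Tb : ℝ, IsIsochronousWithPeriod I Va Ta ∧ IsIsochronousWithPeriod J Vb Tb ∧
        ∃ q : ℚ, Ta / Tb = q :=
  ⟨fun h => h.isochronous hI hI' hJ hJ' hVa hVb hIa hJb hmin, fun ⟨_, _, ha, hb, _, hq⟩ =>
    maximallySuperintegrable_of_isochronous hI hI' hJ hJ' hVa hVb hIa hJb ha hb hq⟩
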